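/- **Setting.** Let $n\ge 2$ workers hold functions $f_1,\dots,f_n:E\to\mathbb R$ on a Hilbert space $E$ ($E=\mathbb R^d$ or $E=\ell^2(\mathbb N)$), and let $f=\frac1n\sum_{i=1}^n f_i$. For $L\ge\mu\ge0$ and $\Delta>0$ write $\{f_i\}\in\mathcal F_{L,\mu}^{\Delta}$ if every $f_i$ is differentiable with $\frac\mu2\|y-x\|^2\le f_i(y)-f_i(x)-\langle\nabla f_i(x),y-x\rangle\le\frac L2\|y-x\|^2$ for all $x,y$, and $f$ has a global minimizer $x^\star$ with $\|x^0-x^\star\|^2\le\Delta$, where $x^0=0$ is the starting point. For $\omega\ge 0$ write $\{C_i\}\in\mathcal U_\omega^{\rm ind}$ if $C_1,\dots,C_n$ are random operators on $E$ with $\mathbb E[C_i(x)]=x$ and $\mathbb E\|C_i(x)-x\|^2\le\omega\|x\|^2$ for all $x$, and $C_1(x_1),\dots,C_n(x_n)$ are mutually independent for all $x_1,\dots,x_n$. A (possibly randomized) *centralized, synchronous, linear-spanning algorithm with compressors $\{C_i\}$* proceeds in rounds $t=1,2,\dots$: the server broadcasts $u^t$; each worker $i$ queries $\nabla f_i$ at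 the points of a set $\mathcal Y_i^t$ and forms a vector $v_i^t$; the server receives $\hat v_i^t=C_i(v_i^t)$, the randomness of the compressors being fresh in every round, that is, independent of everything before. It is required that 1. $u^t\in\mathrm{span}(\{u^r\}_{r<t}\cup\{\hat v_i^r\}_{i\le n,\,r<t})$ (so $u^1=x^0=0$); 2. $\mathcal Y_i^t\subseteq\mathrm{span}(\{u^r\}_{r\le t}\cup\{\nabla f_i(y):y\in\mathcal Y_i^r,\,r<t\}\cup\{\hat v_i^r\}_{r<t})$; 3. $v_i^t\in\mathrm{span}(\{u^r\}_{r\le t}\cup\{\nabla f_i(y):y\in\mathcal Y_i^r,\,r\le t\}\cup\{\hat v_i^r\}_{r<t})$; 4. the output after $t$ rounds satisfies $\hat x^t\in\mathrm{span}(\{u^r\}_{r\le t}\cup\{\hat v_i^r\}_{i\le n,\,r\le t})$. Let $T_\epsilon=\min\{t\in\mathbb N:\mathbb E[f(\hat x^t)]-\min f\le\epsilon\}\in\mathbb N\cup\{\infty\}$. **Theorem.** * **Strongly convex case.** There are constants $c_{n,\kappa}>0$ depending only on $n$ and $\kappa$, and for each $\delta>0$ a constant $a_\delta>0$ depending only on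 $\delta$, such that for all $n\ge2$, $L\ge\mu>0$, $\Delta>0$, $\omega\ge0$, with $\kappa=L/\mu$ and ($\kappa\ge1+\delta$ or $\omega\ge\delta$), the following holds. There are $\{f_i\}\in\mathcal F_{L,\mu}^\Delta$ on $\ell^2(\mathbb N)$ and $\{C_i\}\in\mathcal U_\omega^{\rm ind}$ such that every linear-spanning algorithm with these compressors satisfies $$T_\epsilon\ \ge\ a_\delta\Big(\omega+\big(1+\tfrac{\omega}{\sqrt n}\big)\sqrt{\kappa}\Big)\ln\frac{\mu\Delta}{\epsilon}\qquad\text{for all }0<\epsilon\le c_{n,\kappa}\,\mu\Delta.$$ Moreover, for each such $\epsilon$ there are a dimension $d$, $\{f_i\}\in\mathcal F_{L,\mu}^\Delta$ on $\mathbb R^d$ and $\{C_i\}\in\mathcal U_\omega^{\rm ind}$ such that every linear-spanning algorithm with these compressors satisfies the same bound for this $\epsilon$. * **Generally convex case.** There are constants $c_n>0$ depending only on $n$, and an absolute constant $a>0$, such that for all $n\ge2$, $L\ge0$, $\Delta>0$, $\omega\ge0$ and $0<\epsilon\le c_nL\Delta$ there are a dimension $d$, $\{f_i\}\in\mathcal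 F_{L,0}^\Delta$ on $\mathbb R^d$ and $\{C_i\}\in\mathcal U_\omega^{\rm ind}$ such that every linear-spanning algorithm with these compressors satisfies $$T_\epsilon\ \ge\ a\Big(\omega\ln\frac{L\Delta}{\epsilon}+\big(1+\tfrac{\omega}{\sqrt n}\big)\sqrt{\frac{L\Delta}{\epsilon}}\Big).$$ -/

import Mathlib

open MeasureTheory ProbabilityTheory
open scoped ENNReal

universe u

/-- The real sequence space `ℓ²(ℕ)`. -/
abbrev EllTwo : Type := lp (fun _ : ℕ => ℝ) 2

noncomputable instance instMeasurableSpaceEllTwo : MeasurableSpace EllTwo := borel EllTwo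

instance instBorelSpaceEllTwo : BorelSpace EllTwo := ⟨rfl⟩

noncomputable section

/-- The global objective `f(x) = (1/n) ∑ᵢ fᵢ(x)`. -/
def globalObjective {E : Type} {n : ℕ} (f : Fin n → E → ℝ) (x : E) : ℝ :=
  (1 / (n : ℝ)) * ∑ i, f i x

/-- The class of families `(f₁, …, fₙ)` of local functions such that each `fᵢ` is differentiable,
`L`-smooth and `μ`-strongly convex (for `μ = 0`: convex), and such that the average `f` has a
global minimizer `x⋆` with `‖x⁰ - x⋆‖² ≤ Δ`. -/
structure FunctionClass {E : Type} [NormedAddCommGroup E] [InnerProductSpace ℝ E]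
    [CompleteSpace E] {n : ℕ} (L μ Δ : ℝ) (x₀ : E) (f : Fin n → E → ℝ) : Prop where
  differentiable : ∀ i, Differentiable ℝ (f i)
  lower : ∀ i x y,
    μ / 2 * ‖y - x‖ ^ 2 ≤ f i y - f i x - inner ℝ (gradient (f i) x) (y - x)
  upper : ∀ i x y,
    f i y - f i x - inner ℝ (gradient (f i) x) (y - x) ≤ L / 2 * ‖y - x‖ ^ 2
  exists_minimizer : ∃ xstar : E,
    (∀ x, globalObjective f xstar ≤ globalObjective f x) ∧ ‖x₀ - xstar‖ ^ 2 ≤ Δ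

/-- A family of `n` random operators `C₁, …, Cₙ : E → E`, given on a common probability space
`(Seed, law)`: with the random seed `s`, the operator `Cᵢ` maps `x` to `op i s x`. -/
structure CompressorFamily (n : ℕ) (E : Type) [MeasurableSpace E] where
  /-- the sample space of one use of the compressors -/
  Seed : Type
  [mSeed : MeasurableSpace Seed]
  /-- the distribution of the randomness of one use of the compressors -/
  law : Measure Seed
  [isProb : IsProbabilityMeasure law]
  /-- the compressors -/
  op : Fin n → Seed → E → E
  measurable_op : ∀ i, Measurable (fun p : Seed × E => op i p.1 p.2)

attribute [instance] CompressorFamily.mSeed CompressorFamily.isProb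

/-- Every `Cᵢ` is `ω`-unbiased: `𝔼[Cᵢ(x)] = x` and `𝔼‖Cᵢ(x) - x‖² ≤ ω‖x‖²` for every `x`. -/
structure CompressorFamily.IsUnbiased {n : ℕ} {E : Type} [NormedAddCommGroup E]
    [InnerProductSpace ℝ E] [CompleteSpace E] [MeasurableSpace E]
    (C : CompressorFamily n E) (ω : ℝ) : Prop where
  memLp : ∀ i x, MemLp (fun s => C.op i s x) 2 C.law
  mean : ∀ i x, ∫ s, C.op i s x ∂C.law = x
  variance : ∀ i x, ∫ s, ‖C.op i s x - x‖ ^ 2 ∂C.law ≤ ω * ‖x‖ ^ 2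

/-- The outputs `C₁(x₁), …, Cₙ(xₙ)` are mutually independent, for all inputs `x₁, …, xₙ`. -/
def CompressorFamily.IsIndependent {n : ℕ} {E : Type} [MeasurableSpace E]
    (C : CompressorFamily n E) : Prop :=
  ∀ x : Fin n → E, iIndepFun (fun i s => C.op i s (x i)) C.law

/-- A centralized, synchronous, linear-spanning algorithm with compression, as executed on the
local functions `f` with the compressors `C`, starting from `x⁰ = 0`.  The algorithm may be
randomized; everything lives on a probability space `(Ω, P)`.

Rounds are indexed from `0`, so index `t` stands for the `(t+1)`-st communication round:
the server broadcasts `u t`; worker `i` queries its gradient at all points of the set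
`queries t i` and then holds the vector `v t i`; the server receives `Cᵢ (v t i)`, where the
compressors use the randomness `seed t`.  `output t` is the server's output after `t` rounds, and
`history t` is the information (internal randomness included) produced up to the end of the first
`t` rounds, on which the decisions before the compression in round `t` are based.  The seed of each
round is a fresh sample, independent of the history. -/
structure LinearSpanningAlgorithm {E : Type} [NormedAddCommGroup E] [InnerProductSpace ℝ E]
    [CompleteSpace E] [MeasurableSpace E] {n : ℕ} (f : Fin n → E → ℝ)
    (C : CompressorFamily n E) where
  Ω : Type u
  [mΩ : MeasurableSpace Ω]
  P : Measure Ω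
  [isProb : IsProbabilityMeasure P]
  history : Filtration ℕ mΩ
  seed : ℕ → Ω → C.Seed
  u : ℕ → Ω → E
  queries : ℕ → Fin n → Ω → Set E
  v : ℕ → Fin n → Ω → E
  output : ℕ → Ω → E
  measurable_seed : ∀ t, Measurable[history (t + 1)] (seed t)
  law_seed : ∀ t, P.map (seed t) = C.law
  indep_seed : ∀ t, Indep (history t) (MeasurableSpace.comap (seed t) C.mSeed) P
  measurable_u : ∀ t, Measurable[history t] (u t)
  measurable_v : ∀ t i, Measurable[history t] (v t i)
  measurable_output : ∀ t, Measurable[history t] (output t)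
  /-- The server sends a combination of the messages it has sent and received before
  (so the first broadcast is `x⁰ = 0`). -/
  u_mem : ∀ t w, u t w ∈ Submodule.span ℝ
    ({z | ∃ r < t, z = u r w} ∪ {z | ∃ r < t, ∃ i, z = C.op i (seed r w) (v r i w)})
  /-- Worker `i` queries at combinations of the messages received from the server up to this
  round, and of its gradients and compressed messages from earlier rounds. -/
  queries_subset : ∀ t i w, queries t i w ⊆ Submodule.span ℝ
    ({z | ∃ r ≤ t, z = u r w}
      ∪ {z | ∃ r < t, ∃ y ∈ queries r i w, z = gradient (f i) y}
      ∪ {z | ∃ r < t, z = C.op i (seed r w) (v r i w)})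
  /-- Worker `i` sends (before compression) a combination of the messages received from the server
  and of its gradients up to this round, and of its compressed messages from earlier rounds. -/
  v_mem : ∀ t i w, v t i w ∈ Submodule.span ℝ
    ({z | ∃ r ≤ t, z = u r w}
      ∪ {z | ∃ r ≤ t, ∃ y ∈ queries r i w, z = gradient (f i) y}
      ∪ {z | ∃ r < t, z = C.op i (seed r w) (v r i w)})
  /-- After `t` rounds the server outputs a combination of the messages sent and received. -/
  output_mem : ∀ t w, output t w ∈ Submodule.span ℝ
    ({z | ∃ r < t, z = u r w} ∪ {z | ∃ r < t, ∃ i, z = C.op i (seed r w) (v r i w)})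

attribute [instance] LinearSpanningAlgorithm.mΩ LinearSpanningAlgorithm.isProb

namespace LinearSpanningAlgorithm

variable {E : Type} [NormedAddCommGroup E] [InnerProductSpace ℝ E] [CompleteSpace E]
  [MeasurableSpace E] {n : ℕ} {f : Fin n → E → ℝ} {C : CompressorFamily n E}

/-- The expected error `𝔼[f(x̂ᵗ)] - min f` after `t` rounds, as the integral of the nonnegative
function `f(x̂ᵗ) - min f` (it is `∞` if `f(x̂ᵗ)` is not integrable). -/
def expectedError (A : LinearSpanningAlgorithm.{u} f C) (t : ℕ) : ℝ≥0∞ :=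
  ∫⁻ w, ENNReal.ofReal (globalObjective f (A.output t w) - ⨅ x, globalObjective f x) ∂A.P

/-- The convergence complexity: the least number `t` of communication rounds such that
`𝔼[f(x̂ᵗ)] - min f ≤ ε` (it is `∞` if there is none). -/
def complexity (A : LinearSpanningAlgorithm.{u} f C) (ε : ℝ) : ℕ∞ :=
  ⨅ (t : ℕ) (_ : A.expectedError t ≤ ENNReal.ofReal ε), (t : ℕ∞)

end LinearSpanningAlgorithm

end

/-! Every compressor is a coin: worker `i` transmits `(1 + ω) • x` with probability `1 / (1 + ω)`
and nothing otherwise, independently of the others. The objectives are quadratics built from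
Nesterov's tridiagonal chain, whose links are distributed over two groups of `m` workers: one group
owns the links `2j+1 ↔ 2j+2` and the source at coordinate `0`, the other owns the links `2j ↔ 2j+1`;
the remaining workers hold only `μ/2 ‖x‖²`. A group cannot extend the known coordinates beyond the
end of its own link, so two new coordinates cost at least one message from the first group
(`output_mem_of_successes`).

The minimizer is a geometric sequence of ratio `q`, so after `S` useful rounds the error is at least
about `(μΔ/2) q^(4S)`. If a round is useful with probability at most `p`, independence gives `𝔼
q^(4S) ≥ (1 - p(1 - q⁴))^t ≥ exp(-4p log(1/q) t)`, hence at least a constant times `log(μΔ/ε) / (p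
log(1/q))` rounds (`hasHardInstance_of_chain`). Stationarity of the average ties `q` to `x =
2(κ-1)m/n`, and `1 / log(1/q)` is of order `√x` when `x` is bounded below.

Three choices give the three terms of the bound. With `m = 1` and `p = 1/(1+ω)` the rate is
`(1+ω)√(κ/n)`; with `m = ⌊n/2⌋` and `p = 1` it is `√κ`; a single worker holding all the information
about the minimizer must get one message through, which yields `ω`
(`hasHardInstance_single_message`). The largest term is at least a third of the sum. The generally
convex bound follows by tuning `μ` to `ε`. -/

namespace LinearSpanningAlgorithm

/-! ### Successful rounds, and the decay of the expected error -/

section Progress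

variable {E : Type} [NormedAddCommGroup E] [InnerProductSpace ℝ E] [CompleteSpace E]
  [MeasurableSpace E] {n : ℕ} {f : Fin n → E → ℝ} {C : CompressorFamily n E}

/-- The number of rounds before round `t` in which the seed lies in `B`. -/
noncomputable def successes (A : LinearSpanningAlgorithm.{u} f C) (B : Set C.Seed) (t : ℕ)
    (w : A.Ω) : ℕ :=
  ∑ r ∈ Finset.range t, B.indicator 1 (A.seed r w)

theorem successes_succ (A : LinearSpanningAlgorithm.{u} f C) (B : Set C.Seed) (t : ℕ) (w : A.Ω) :
    A.successes B (t + 1) w = A.successes B t w + B.indicator 1 (A.seed t w) :=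
  Finset.sum_range_succ _ _

theorem successes_mono (A : LinearSpanningAlgorithm.{u} f C) (B : Set C.Seed) (w : A.Ω) :
    Monotone fun t => A.successes B t w :=
  monotone_nat_of_le_succ fun t => by simp [successes_succ]

theorem measurable_successes (A : LinearSpanningAlgorithm.{u} f C) {B : Set C.Seed}
    (hB : MeasurableSet B) (t : ℕ) : Measurable[A.history t] (A.successes B t) := by
  unfold successes
  refine Finset.measurable_fun_sum _ fun r hr => ?_
  have h1 : Measurable[A.history t] (A.seed r) :=
    (A.measurable_seed r).mono (A.history.mono (Finset.mem_range.1 hr)) le_rfl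
  exact (measurable_one.indicator hB).comp h1

/-- If the workers in `G` need a success to communicate, then the number of successes bounds the
position of the output in a filtration `K 0 ≤ H 0 ≤ K 1 ≤ H 1 ≤ ⋯` such that gradients of the
workers in `G` preserve every `H s` and those of the other workers preserve every `K s`. -/
theorem output_mem_of_successes (A : LinearSpanningAlgorithm.{u} f C) (B : Set C.Seed)
    (G : Set (Fin n)) {K H : ℕ → Submodule ℝ E} (hKH : ∀ s, K s ≤ H s) (hHK : ∀ s, H s ≤ K (s + 1))
    (hgK : ∀ i ∉ G, ∀ s, ∀ x ∈ K s, gradient (f i) x ∈ K s)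
    (hgH : ∀ i ∈ G, ∀ s, ∀ x ∈ H s, gradient (f i) x ∈ H s)
    (hop : ∀ i s x, C.op i s x ∈ Submodule.span ℝ {x})
    (hfail : ∀ i ∈ G, ∀ s ∉ B, ∀ x, C.op i s x = 0) (t : ℕ) (w : A.Ω) :
    A.output t w ∈ K (A.successes B t w) := by
  classical
  have hK : Monotone K := monotone_nat_of_le_succ fun s => (hKH s).trans (hHK s)
  have hH : Monotone H := monotone_nat_of_le_succ fun s => (hHK s).trans (hKH _)
  have hS := A.successes_mono B w
  -- `M i s` confines what worker `i` knows after `s` successes; the server stays in `K s`.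
  let M : Fin n → ℕ → Submodule ℝ E := fun i s => if i ∈ G then H s else K s
  have hM : ∀ i, Monotone (M i) := by
    intro i
    by_cases hi : i ∈ G
    · simpa [M, hi] using hH
    · simpa [M, hi] using hK
  have hKM : ∀ i s, K s ≤ M i s := by
    intro i s
    by_cases hi : i ∈ G
    · simpa [M, hi] using hKH s
    · simp [M, hi]
  have hgM : ∀ i s, ∀ x ∈ M i s, gradient (f i) x ∈ M i s := by
    intro i s
    by_cases hi : i ∈ G
    · simpa [M, hi] using hgH i hi s
    · simpa [M, hi] using hgK i hi s
  have hopM : ∀ (N : Submodule ℝ E) i s x, x ∈ N → C.op i s x ∈ N := fun N i s x hx =>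
    (Submodule.span_singleton_le_iff_mem x N).2 hx (hop i s x)
  have key : ∀ t, A.u t w ∈ K (A.successes B t w) ∧
      ∀ i, A.queries t i w ⊆ M i (A.successes B t w) ∧ A.v t i w ∈ M i (A.successes B t w) ∧
        C.op i (A.seed t w) (A.v t i w) ∈ K (A.successes B (t + 1) w) := by
    intro t
    induction t using Nat.strong_induction_on with
    | _ t ih =>
      have hu : A.u t w ∈ K (A.successes B t w) := by
        refine Submodule.span_le.2 ?_ (A.u_mem t w)
        rintro z (⟨r, hr, rfl⟩ | ⟨r, hr, i, rfl⟩)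
        · exact hK (hS hr.le) (ih r hr).1
        · exact hK (hS hr) ((ih r hr).2 i).2.2
      have hu' : ∀ r ≤ t, A.u r w ∈ K (A.successes B t w) := by
        intro r hr
        rcases hr.eq_or_lt with rfl | hr'
        · exact hu
        · exact hK (hS hr) (ih r hr').1
      refine ⟨hu, fun i => ?_⟩
      have hq : A.queries t i w ⊆ M i (A.successes B t w) := by
        refine (A.queries_subset t i w).trans (SetLike.coe_subset_coe.2 (Submodule.span_le.2 ?_))
        rintro z ((⟨r, hr, rfl⟩ | ⟨r, hr, y, hy, rfl⟩) | ⟨r, hr, rfl⟩)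
        · exact hKM i _ (hu' r hr)
        · exact hgM i _ _ (hM i (hS hr.le) (((ih r hr).2 i).1 hy))
        · exact hKM i _ (hK (hS hr) ((ih r hr).2 i).2.2)
      have hv : A.v t i w ∈ M i (A.successes B t w) := by
        refine Submodule.span_le.2 ?_ (A.v_mem t i w)
        rintro z ((⟨r, hr, rfl⟩ | ⟨r, hr, y, hy, rfl⟩) | ⟨r, hr, rfl⟩)
        · exact hKM i _ (hu' r hr)
        · rcases hr.eq_or_lt with rfl | hr'
          · exact hgM i _ _ (hq hy)
          · exact hgM i _ _ (hM i (hS hr) (((ih r hr').2 i).1 hy))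
        · exact hKM i _ (hK (hS hr) ((ih r hr).2 i).2.2)
      refine ⟨hq, hv, ?_⟩
      -- A nonzero message from `G` is the only way to leave `K s`. It lies in `H s ≤ K (s + 1)`,
      -- and the round that carries it is counted as a success.
      by_cases hi : i ∈ G
      · by_cases hs : A.seed t w ∈ B
        · rw [successes_succ, Set.indicator_of_mem hs]
          refine hopM _ _ _ _ (hHK _ ?_)
          simpa [M, hi] using hv
        · rw [hfail i hi _ hs]
          exact zero_mem _
      · refine hopM _ _ _ _ (hK (hS t.le_succ) ?_)
        simpa [M, hi] using hv
  refine Submodule.span_le.2 ?_ (A.output_mem t w)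
  rintro z (⟨r, hr, rfl⟩ | ⟨r, hr, i, rfl⟩)
  · exact hK (hS hr.le) (key r).1
  · exact hK (hS hr) ((key r).2 i).2.2

/-- The success count before round `t` is determined by the history, and the seed of round `t` is
independent of it. The expectation therefore factorises, and each round contributes a factor `1 -
P(B)(1 - θ)`. -/
theorem le_lintegral_pow_successes (A : LinearSpanningAlgorithm.{u} f C) {B : Set C.Seed}
    (hB : MeasurableSet B) {p θ : ℝ} (hp1 : p ≤ 1) (hpB : C.law.real B ≤ p)
    (hθ0 : 0 ≤ θ) (hθ1 : θ ≤ 1) (t : ℕ) :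
    ENNReal.ofReal ((1 - p * (1 - θ)) ^ t) ≤
      ∫⁻ w, ENNReal.ofReal (θ ^ A.successes B t w) ∂A.P := by
  have hp0 : 0 ≤ p := measureReal_nonneg.trans hpB
  have hbase : 0 ≤ 1 - p * (1 - θ) := by nlinarith
  induction t with
  | zero => simp [successes]
  | succ t ih =>
    have hpow : ∀ w, ENNReal.ofReal (θ ^ A.successes B (t + 1) w) =
        ENNReal.ofReal (θ ^ A.successes B t w) *
          ENNReal.ofReal (θ ^ (B.indicator 1 (A.seed t w) : ℕ)) := by
      intro w
      rw [successes_succ, pow_add, ENNReal.ofReal_mul (by positivity)]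
    have hm1 : Measurable[A.history t] fun w => ENNReal.ofReal (θ ^ A.successes B t w) :=
      (measurable_from_top (f := fun k : ℕ => ENNReal.ofReal (θ ^ k))).comp
        (A.measurable_successes hB t)
    have hg : Measurable fun s : C.Seed => ENNReal.ofReal (θ ^ (B.indicator 1 s : ℕ)) :=
      (measurable_from_top (f := fun k : ℕ => ENNReal.ofReal (θ ^ k))).comp
        (measurable_one.indicator hB)
    have hseed : Measurable (A.seed t) := (A.measurable_seed t).mono (A.history.le _) le_rfl
    have hm2 : Measurable[MeasurableSpace.comap (A.seed t) C.mSeed]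
        fun w => ENNReal.ofReal (θ ^ (B.indicator 1 (A.seed t w) : ℕ)) :=
      hg.comp (comap_measurable _)
    have hstep : ENNReal.ofReal (1 - p * (1 - θ)) ≤
        ∫⁻ w, ENNReal.ofReal (θ ^ (B.indicator 1 (A.seed t w) : ℕ)) ∂A.P := by
      rw [← lintegral_map (f := fun s => ENNReal.ofReal (θ ^ (B.indicator 1 s : ℕ))) hg hseed,
        A.law_seed t]
      have hsplit : ∀ s : C.Seed, ENNReal.ofReal (θ ^ (B.indicator 1 s : ℕ)) =
          B.indicator (fun _ => ENNReal.ofReal θ) s + Bᶜ.indicator (fun _ => 1) s := by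
        intro s
        by_cases hs : s ∈ B <;> simp [hs]
      simp_rw [hsplit]
      rw [lintegral_add_left (measurable_const.indicator hB), lintegral_indicator_const hB,
        lintegral_indicator_const hB.compl, one_mul, ← ofReal_measureReal, ← ofReal_measureReal,
        ← ENNReal.ofReal_mul hθ0, ← ENNReal.ofReal_add (by positivity) (by positivity),
        probReal_compl_eq_one_sub hB]
      apply ENNReal.ofReal_le_ofReal
      nlinarith
    simp_rw [hpow]
    rw [lintegral_mul_eq_lintegral_mul_lintegral_of_independent_measurableSpace (A.history.le t)
      hseed.comap_le (A.indep_seed t) hm1 hm2, pow_succ, ENNReal.ofReal_mul (by positivity)]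
    gcongr

theorem le_of_expectedError_le (A : LinearSpanningAlgorithm.{u} f C) {B : Set C.Seed}
    (hB : MeasurableSet B) {p θ c η ε : ℝ} (hp1 : p ≤ 1) (hpB : C.law.real B ≤ p)
    (hθ0 : 0 ≤ θ) (hθ1 : θ ≤ 1) (hc : 0 ≤ c) (hη : 0 ≤ η) (hε : 0 ≤ ε) {t : ℕ}
    (herr : ∀ w, c * (θ ^ A.successes B t w - η) ≤
      globalObjective f (A.output t w) - ⨅ x, globalObjective f x)
    (ht : A.expectedError t ≤ ENNReal.ofReal ε) :
    c * ((1 - p * (1 - θ)) ^ t - η) ≤ ε := by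
  have h1 : ENNReal.ofReal c * ENNReal.ofReal ((1 - p * (1 - θ)) ^ t) ≤
      ENNReal.ofReal ε + ENNReal.ofReal (c * η) := by
    calc
      _ ≤ ENNReal.ofReal c * ∫⁻ w, ENNReal.ofReal (θ ^ A.successes B t w) ∂A.P := by
        gcongr
        exact A.le_lintegral_pow_successes hB hp1 hpB hθ0 hθ1 t
      _ = ∫⁻ w, ENNReal.ofReal (c * θ ^ A.successes B t w) ∂A.P := by
        rw [← lintegral_const_mul' _ _ ENNReal.ofReal_ne_top]
        simp_rw [ENNReal.ofReal_mul hc]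
      _ ≤ ∫⁻ w, (ENNReal.ofReal (globalObjective f (A.output t w) - ⨅ x, globalObjective f x)
            + ENNReal.ofReal (c * η)) ∂A.P := by
        refine lintegral_mono fun w => ?_
        refine le_trans (ENNReal.ofReal_le_ofReal ?_) ENNReal.ofReal_add_le
        linarith [herr w]
      _ = A.expectedError t + ENNReal.ofReal (c * η) := by
        rw [lintegral_add_right _ measurable_const]
        simp [expectedError]
      _ ≤ _ := by gcongr
  rw [← ENNReal.ofReal_mul hc, ← ENNReal.ofReal_add hε (by positivity),
    ENNReal.ofReal_le_ofReal_iff (by positivity)] at h1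
  linarith

theorem ofReal_le_complexity (A : LinearSpanningAlgorithm.{u} f C) {x ε : ℝ}
    (h : ∀ t : ℕ, A.expectedError t ≤ ENNReal.ofReal ε → x ≤ t) :
    ENNReal.ofReal x ≤ (A.complexity ε : ℝ≥0∞) := by
  have h1 : ((⌈x⌉₊ : ℕ) : ℕ∞) ≤ A.complexity ε :=
    le_iInf₂ fun t ht => by exact_mod_cast Nat.ceil_le.2 (h t ht)
  have h2 : (((⌈x⌉₊ : ℕ) : ℕ∞) : ℝ≥0∞) ≤ (A.complexity ε : ℝ≥0∞) := ENat.toENNReal_mono h1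
  refine le_trans ?_ h2
  rw [ENat.toENNReal_coe, ← ENNReal.ofReal_natCast]
  exact ENNReal.ofReal_le_ofReal (Nat.le_ceil x)

/-- The number of rounds grows at least like `log (1 / ε) / (2ρ)` if the expected error decays at
most like `exp (-ρt)` in the number `t` of rounds. -/
theorem ofReal_log_le_complexity (A : LinearSpanningAlgorithm.{u} f C) {B : Set C.Seed}
    (hB : MeasurableSet B) {p θ D η ε ρ : ℝ} (hp1 : p ≤ 1) (hpB : C.law.real B ≤ p)
    (hθ0 : 0 ≤ θ) (hθ1 : θ ≤ 1) (hρ : 0 < ρ) (hρp : Real.exp (-ρ) ≤ 1 - p * (1 - θ))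
    (hη : 0 ≤ η) (hε : 0 < ε) (hεD : ε ≤ 1 / 16 * D) (hηε : D / 2 * η ≤ ε)
    (herr : ∀ t w, D / 2 * (θ ^ A.successes B t w - η) ≤
      globalObjective f (A.output t w) - ⨅ x, globalObjective f x) :
    ENNReal.ofReal (1 / (2 * ρ) * Real.log (D / ε)) ≤ (A.complexity ε : ℝ≥0∞) := by
  refine A.ofReal_le_complexity fun t ht => ?_
  have hD : 0 < D := by linarith
  have h1 := A.le_of_expectedError_le hB hp1 hpB hθ0 hθ1 (by positivity) hη hε.le (herr t) ht
  have h2 : Real.exp (-ρ) ^ t ≤ (1 - p * (1 - θ)) ^ t := by gcongr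
  -- One `ε` is the allowed error, the other absorbs the truncation term `D / 2 * η`.
  have h3 : D / 2 * Real.exp (-ρ) ^ t ≤ 2 * ε := by
    have := mul_le_mul_of_nonneg_left h2 (by positivity : 0 ≤ D / 2)
    linarith
  have hx : 16 ≤ D / ε := by rw [le_div_iff₀ hε]; linarith
  have h4 : D / ε ≤ 4 * Real.exp (ρ * t) := by
    rw [← Real.exp_nat_mul] at h3
    rw [div_le_iff₀ hε]
    have h5 : Real.exp (ρ * t) * Real.exp (t * -ρ) = 1 := by
      rw [← Real.exp_add]; simp [mul_comm]
    have := mul_le_mul_of_nonneg_left h3 (Real.exp_pos (ρ * t)).le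
    nlinarith
  have h5 : Real.log (D / ε) ≤ Real.log 4 + ρ * t := by
    rw [← Real.log_exp (ρ * t), ← Real.log_mul (by norm_num) (by positivity)]
    exact Real.log_le_log (by positivity) h4
  -- `D / ε ≥ 16 = 4²`, so `log 4` consumes at most half of `log (D / ε)`; this is the origin of the
  -- constant `1 / 16`.
  have h6 : 2 * Real.log 4 ≤ Real.log (D / ε) := by
    rw [← Real.log_rpow (by norm_num)]
    exact Real.log_le_log (by positivity) (by norm_num; linarith)
  rw [div_mul_eq_mul_div, div_le_iff₀ (by positivity)]
  linarith

end Progress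

end LinearSpanningAlgorithm

/-! ### Independent coin-flip compressors -/

section CoinCompressor

/-- The Bernoulli distribution on `Bool` with success probability `1 / (1 + ω)`. -/
noncomputable def coinLaw (ω : ℝ) : Measure Bool :=
  ENNReal.ofReal (1 / (1 + ω)) • Measure.dirac true +
    ENNReal.ofReal (ω / (1 + ω)) • Measure.dirac false

theorem isProbabilityMeasure_coinLaw {ω : ℝ} (hω : 0 ≤ ω) : IsProbabilityMeasure (coinLaw ω) := by
  constructor
  have h : 1 / (1 + ω) + ω / (1 + ω) = 1 := by field_simp
  simp only [coinLaw, Measure.add_apply, Measure.smul_apply, measure_univ, smul_eq_mul, mul_one]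
  rw [← ENNReal.ofReal_add (by positivity) (by positivity), h, ENNReal.ofReal_one]

theorem integral_coinLaw {E : Type*} [NormedAddCommGroup E] [NormedSpace ℝ E] [CompleteSpace E]
    {ω : ℝ} (hω : 0 ≤ ω) (g : Bool → E) :
    ∫ s, g s ∂coinLaw ω = (1 / (1 + ω)) • g true + (ω / (1 + ω)) • g false := by
  have hi : ∀ b, Integrable g (Measure.dirac b) := fun b => .of_finite
  rw [coinLaw, integral_add_measure ((hi _).smul_measure ENNReal.ofReal_ne_top)
    ((hi _).smul_measure ENNReal.ofReal_ne_top), integral_smul_measure, integral_smul_measure,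
    integral_dirac, integral_dirac, ENNReal.toReal_ofReal (by positivity),
    ENNReal.toReal_ofReal (by positivity)]

/-- The compressors which independently of each other transmit `(1 + ω)x` with probability
`1 / (1 + ω)` and nothing otherwise. -/
noncomputable def coinCompressor (n : ℕ) (E : Type) [NormedAddCommGroup E] [NormedSpace ℝ E]
    [MeasurableSpace E] [BorelSpace E] (ω : ℝ) (hω : 0 ≤ ω) : CompressorFamily n E :=
  haveI := isProbabilityMeasure_coinLaw hω
  { Seed := Fin n → Bool
    law := Measure.pi fun _ => coinLaw ω
    op := fun i s x => if s i then (1 + ω) • x else 0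
    measurable_op := fun i => by
      refine Measurable.ite ?_ (measurable_snd.const_smul _) measurable_const
      have h : Measurable fun p : (Fin n → Bool) × E => p.1 i :=
        (measurable_pi_apply i).comp measurable_fst
      exact h (measurableSet_singleton true) }

variable {n : ℕ} {E : Type} [NormedAddCommGroup E] [InnerProductSpace ℝ E]
  [MeasurableSpace E] [BorelSpace E] {ω : ℝ}

theorem integral_coinCompressor_law {F : Type*} [NormedAddCommGroup F] [NormedSpace ℝ F]
    [CompleteSpace F] (hω : 0 ≤ ω) (i : Fin n) (g : Bool → F) :
    ∫ s : Fin n → Bool, g (s i) ∂(coinCompressor n E ω hω).law =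
      (1 / (1 + ω)) • g true + (ω / (1 + ω)) • g false := by
  have := isProbabilityMeasure_coinLaw hω
  rw [← integral_coinLaw hω g]
  have h := measurePreserving_eval (fun _ : Fin n => coinLaw ω) i
  rw [← h.map_eq, integral_map h.measurable.aemeasurable
    (StronglyMeasurable.of_discrete).aestronglyMeasurable]
  rfl

theorem coinCompressor_isUnbiased [CompleteSpace E] (hω : 0 ≤ ω) :
    (coinCompressor n E ω hω).IsUnbiased ω where
  memLp i x := by
    have : MeasurableSingletonClass (coinCompressor n E ω hω).Seed :=
      inferInstanceAs (MeasurableSingletonClass (Fin n → Bool))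
    have : Finite (coinCompressor n E ω hω).Seed := inferInstanceAs (Finite (Fin n → Bool))
    exact MemLp.of_discrete
  mean i x := by
    refine (integral_coinCompressor_law hω i
      (fun b : Bool => if b then (1 + ω) • x else 0)).trans ?_
    have : (1 + ω) ≠ 0 := by positivity
    simp [smul_smul, this]
  variance i x := by
    refine le_of_eq ((integral_coinCompressor_law hω i
      (fun b : Bool => ‖(if b then (1 + ω) • x else 0) - x‖ ^ 2)).trans ?_)
    have h : (1 + ω) • x - x = ω • x := by rw [add_smul, one_smul, add_sub_cancel_left]
    simp only [if_true, h, norm_smul, Real.norm_eq_abs, mul_pow, sq_abs, Bool.false_eq_true,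
      if_false, zero_sub, norm_neg, smul_eq_mul]
    field_simp
    ring

theorem coinCompressor_isIndependent (hω : 0 ≤ ω) : (coinCompressor n E ω hω).IsIndependent := by
  have := isProbabilityMeasure_coinLaw hω
  intro x
  exact iIndepFun_pi (μ := fun _ : Fin n => coinLaw ω)
    (X := fun i (b : Bool) => if b then (1 + ω) • x i else 0)
    (fun i => (measurable_of_countable _).aemeasurable)

theorem coinCompressor_op_mem_span (hω : 0 ≤ ω) (i : Fin n)
    (s : (coinCompressor n E ω hω).Seed) (x : E) :
    (coinCompressor n E ω hω).op i s x ∈ Submodule.span ℝ {x} := by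
  change (if s i then (1 + ω) • x else 0) ∈ _
  split_ifs
  · exact Submodule.smul_mem _ _ (Submodule.mem_span_singleton_self x)
  · exact zero_mem _

/-- The event that worker `i` transmits. -/
def coinSuccess (hω : 0 ≤ ω) (i : Fin n) : Set (coinCompressor n E ω hω).Seed :=
  {s : Fin n → Bool | s i = true}

theorem measurableSet_coinSuccess (hω : 0 ≤ ω) (i : Fin n) :
    MeasurableSet (coinSuccess (E := E) hω i) :=
  (measurable_pi_apply (X := fun _ : Fin n => Bool) i) (measurableSet_singleton true)

theorem coinCompressor_op_eq_zero (hω : 0 ≤ ω) {i : Fin n}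
    {s : (coinCompressor n E ω hω).Seed} (hs : s ∉ coinSuccess (E := E) hω i) (x : E) :
    (coinCompressor n E ω hω).op i s x = 0 :=
  if_neg hs

theorem law_real_coinSuccess (hω : 0 ≤ ω) (i : Fin n) :
    (coinCompressor n E ω hω).law.real (coinSuccess (E := E) hω i) = 1 / (1 + ω) := by
  have h := integral_coinCompressor_law (E := E) hω i (fun b : Bool => if b then (1 : ℝ) else 0)
  rw [← integral_indicator_one (measurableSet_coinSuccess hω i)]
  refine Eq.trans (integral_congr_ae (.of_forall fun s => ?_)) (h.trans (by simp))
  by_cases hs : s ∈ coinSuccess (E := E) hω i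
  · rw [Set.indicator_of_mem hs]
    exact (if_pos hs).symm
  · rw [Set.indicator_of_notMem hs]
    exact (if_neg hs).symm

end CoinCompressor

/-! ### Quadratics with Hessian between `μ` and `L` -/

section Quadratic

variable {E : Type} [NormedAddCommGroup E] [InnerProductSpace ℝ E]

/-- A symmetric contraction. -/
structure IsSymmContraction (R : E →L[ℝ] E) : Prop where
  symm : ∀ x y, inner ℝ (R x) y = inner ℝ x (R y)
  norm_le : ∀ x, ‖R x‖ ≤ ‖x‖

theorem IsSymmContraction.id : IsSymmContraction (ContinuousLinearMap.id ℝ E) :=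
  ⟨fun _ _ => rfl, fun _ => le_rfl⟩

/-- The quadratic function with Hessian `μ + (L - μ)(1 - R) / 2` and gradient `-b` at `0`. -/
noncomputable def quadratic (L μ : ℝ) (R : E →L[ℝ] E) (b x : E) : ℝ :=
  μ / 2 * ‖x‖ ^ 2 + (L - μ) / 4 * (‖x‖ ^ 2 - inner ℝ (R x) x) - inner ℝ b x

/-- The gradient of `quadratic`. -/
noncomputable def quadraticGrad (L μ : ℝ) (R : E →L[ℝ] E) (b x : E) : E :=
  μ • x + ((L - μ) / 2) • (x - R x) - b

variable {L μ : ℝ} {R : E →L[ℝ] E}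

/-- The second-order expansion of a quadratic is exact. The contraction property puts the remainder
between the `μ` and `L` bounds, which yields the function class and also differentiability. -/
theorem quadratic_sub (hR : IsSymmContraction R) (b x y : E) :
    quadratic L μ R b y - quadratic L μ R b x - inner ℝ (quadraticGrad L μ R b x) (y - x) =
      μ / 2 * ‖y - x‖ ^ 2 + (L - μ) / 4 * (‖y - x‖ ^ 2 - inner ℝ (R (y - x)) (y - x)) := by
  obtain ⟨h, rfl⟩ : ∃ h, y = x + h := ⟨y - x, by abel⟩
  have h1 : inner ℝ (R h) x = inner ℝ (R x) h := by rw [hR.symm, real_inner_comm]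
  simp only [quadratic, quadraticGrad, add_sub_cancel_left, map_add, inner_add_left,
    inner_add_right, inner_sub_left, real_inner_smul_left, norm_add_sq_real, h1]
  ring

theorem IsSymmContraction.inner_bound (hR : IsSymmContraction R) (h : E) :
    0 ≤ ‖h‖ ^ 2 - inner ℝ (R h) h ∧ ‖h‖ ^ 2 - inner ℝ (R h) h ≤ 2 * ‖h‖ ^ 2 := by
  have h1 := abs_le.1 (abs_real_inner_le_norm (R h) h)
  have h2 := mul_le_mul_of_nonneg_right (hR.norm_le h) (norm_nonneg h)
  constructor <;> nlinarith

theorem quadratic_lower (hR : IsSymmContraction R) (hμL : μ ≤ L) (b x y : E) :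
    μ / 2 * ‖y - x‖ ^ 2 ≤
      quadratic L μ R b y - quadratic L μ R b x - inner ℝ (quadraticGrad L μ R b x) (y - x) := by
  rw [quadratic_sub hR]
  have := mul_nonneg (by linarith : 0 ≤ (L - μ) / 4) (hR.inner_bound (y - x)).1
  linarith

theorem quadratic_upper (hR : IsSymmContraction R) (hμL : μ ≤ L) (b x y : E) :
    quadratic L μ R b y - quadratic L μ R b x - inner ℝ (quadraticGrad L μ R b x) (y - x) ≤
      L / 2 * ‖y - x‖ ^ 2 := by
  rw [quadratic_sub hR]
  have := mul_le_mul_of_nonneg_left (hR.inner_bound (y - x)).2 (by linarith : 0 ≤ (L - μ) / 4)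
  linarith

theorem hasGradientAt_quadratic [CompleteSpace E] (hR : IsSymmContraction R) (hμ : 0 ≤ μ)
    (hμL : μ ≤ L) (b x : E) :
    HasGradientAt (quadratic L μ R b) (quadraticGrad L μ R b x) x := by
  rw [hasGradientAt_iff_isLittleO]
  have h1 : (fun y => quadratic L μ R b y - quadratic L μ R b x -
      inner ℝ (quadraticGrad L μ R b x) (y - x)) =O[nhds x] fun y => ‖y - x‖ ^ 2 := by
    refine Asymptotics.IsBigO.of_bound (L / 2) (.of_forall fun y => ?_)
    have h0 : 0 ≤ μ / 2 * ‖y - x‖ ^ 2 := by positivity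
    rw [Real.norm_of_nonneg (h0.trans (quadratic_lower hR hμL b x y)),
      Real.norm_of_nonneg (by positivity)]
    exact quadratic_upper hR hμL b x y
  refine h1.trans_isLittleO ?_
  have h2 : (fun h : E => ‖h‖ ^ 2) =o[nhds 0] fun h => h :=
    Asymptotics.isLittleO_norm_pow_id one_lt_two
  have h3 : Filter.Tendsto (fun y => y - x) (nhds x) (nhds 0) := by
    have := (continuous_sub_right x).tendsto x
    simpa using this
  exact h2.comp_tendsto h3

variable {n : ℕ} {R : Fin n → E →L[ℝ] E} {b : Fin n → E} {xs : E}

theorem globalObjective_quadratic_sub_ge (hn : 0 < n) (hμL : μ ≤ L)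
    (hR : ∀ i, IsSymmContraction (R i)) (hxs : ∑ i, quadraticGrad L μ (R i) (b i) xs = 0) (x : E) :
    μ / 2 * ‖x - xs‖ ^ 2 ≤ globalObjective (fun i => quadratic L μ (R i) (b i)) x -
      globalObjective (fun i => quadratic L μ (R i) (b i)) xs := by
  have hn' : (0 : ℝ) < n := by exact_mod_cast hn
  have h1 : ∑ _i : Fin n, μ / 2 * ‖x - xs‖ ^ 2 ≤ ∑ i, (quadratic L μ (R i) (b i) x -
      quadratic L μ (R i) (b i) xs - inner ℝ (quadraticGrad L μ (R i) (b i) xs) (x - xs)) :=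
    Finset.sum_le_sum fun i _ => quadratic_lower (hR i) hμL _ _ _
  rw [Finset.sum_sub_distrib, Finset.sum_sub_distrib, ← sum_inner, hxs, inner_zero_left, sub_zero,
    Finset.sum_const, Finset.card_univ, Fintype.card_fin, nsmul_eq_mul] at h1
  unfold globalObjective
  rw [← mul_sub, one_div, le_inv_mul_iff₀ hn']
  exact h1

theorem functionClass_quadratic [CompleteSpace E] (hn : 0 < n) (hμ : 0 ≤ μ) (hμL : μ ≤ L)
    (hR : ∀ i, IsSymmContraction (R i)) (hxs : ∑ i, quadraticGrad L μ (R i) (b i) xs = 0) {Δ : ℝ}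
    (hΔ : ‖xs‖ ^ 2 ≤ Δ) : FunctionClass L μ Δ 0 (fun i => quadratic L μ (R i) (b i)) where
  differentiable i x := (hasGradientAt_quadratic (hR i) hμ hμL (b i) x).differentiableAt
  lower i x y := by
    rw [(hasGradientAt_quadratic (hR i) hμ hμL (b i) x).gradient]
    exact quadratic_lower (hR i) hμL _ _ _
  upper i x y := by
    rw [(hasGradientAt_quadratic (hR i) hμ hμL (b i) x).gradient]
    exact quadratic_upper (hR i) hμL _ _ _
  exists_minimizer := by
    refine ⟨xs, fun x => ?_, by simpa using hΔ⟩
    have := globalObjective_quadratic_sub_ge hn hμL hR hxs x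
    have : 0 ≤ μ / 2 * ‖x - xs‖ ^ 2 := by positivity
    linarith

theorem globalObjective_quadratic_sub_iInf_ge (hn : 0 < n) (hμ : 0 ≤ μ) (hμL : μ ≤ L)
    (hR : ∀ i, IsSymmContraction (R i)) (hxs : ∑ i, quadraticGrad L μ (R i) (b i) xs = 0) (x : E) :
    μ / 2 * ‖x - xs‖ ^ 2 ≤ globalObjective (fun i => quadratic L μ (R i) (b i)) x -
      ⨅ y, globalObjective (fun i => quadratic L μ (R i) (b i)) y := by
  have h := globalObjective_quadratic_sub_ge hn hμL hR hxs
  have hbdd : BddBelow (Set.range fun y => globalObjective (fun i => quadratic L μ (R i) (b i)) y) :=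
    ⟨globalObjective (fun i => quadratic L μ (R i) (b i)) xs, by
      rintro _ ⟨y, rfl⟩
      have h0 : 0 ≤ μ / 2 * ‖y - xs‖ ^ 2 := by positivity
      have h1 := h y
      simp only
      linarith⟩
  have := ciInf_le hbdd xs
  linarith [h x]

theorem quadraticGrad_mem {R : E →L[ℝ] E} {b x : E} {N : Submodule ℝ E} (hx : x ∈ N)
    (hRx : R x ∈ N) (hb : b ∈ N) : quadraticGrad L μ R b x ∈ N :=
  N.sub_mem (N.add_mem (N.smul_mem _ hx) (N.smul_mem _ (N.sub_mem hx hRx))) hb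

end Quadratic

/-! ### Quadratic chains on `ℓ²` and on its truncations -/

section Chain

/-- The data of a quadratic chain: `R₁` and `R₂` preserve every second member of the filtration
`K 0 ≤ H 0 ≤ K 1 ≤ H 1 ≤ ⋯`, the source `b` lies in `H 0`, and the solution `xs` of the equation
`(q + q⁻¹) xs - R₁ xs - R₂ xs = b` has distance at least `Δ(q⁴ˢ - η)` from `K s`. -/
structure IsQuadraticChain {E : Type} [NormedAddCommGroup E] [InnerProductSpace ℝ E] (q Δ η : ℝ)
    (R₁ R₂ : E →L[ℝ] E) (b xs : E) (K H : ℕ → Submodule ℝ E) : Prop where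
  contraction₁ : IsSymmContraction R₁
  contraction₂ : IsSymmContraction R₂
  le_odd : ∀ s, K s ≤ H s
  le_even : ∀ s, H s ≤ K (s + 1)
  maps₁ : ∀ s, ∀ x ∈ H s, R₁ x ∈ H s
  maps₂ : ∀ s, ∀ x ∈ K s, R₂ x ∈ K s
  source_mem : b ∈ H 0
  equation : (q + q⁻¹) • xs - R₁ xs - R₂ xs = b
  norm_le : ‖xs‖ ^ 2 ≤ Δ
  dist_ge : ∀ s, ∀ x ∈ K s, Δ * (q ^ (4 * s) - η) ≤ ‖x - xs‖ ^ 2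

variable {ι : Type}

theorem lp_two_norm_sq (x : lp (fun _ : ι => ℝ) 2) : HasSum (fun k => x k ^ 2) (‖x‖ ^ 2) := by
  have h := lp.hasSum_norm (p := 2) (by norm_num) x
  simpa using h

theorem memℓp_two_iff {g : ι → ℝ} : Memℓp g 2 ↔ Summable fun k => g k ^ 2 := by
  rw [memℓp_gen_iff (by norm_num)]
  simp

theorem summable_weighted_comp {w : ι → ℝ} (hw : ∀ k, |w k| ≤ 1) (σ : Equiv.Perm ι)
    (x : lp (fun _ : ι => ℝ) 2) :
    (Summable fun k => (w k * x (σ k)) ^ 2) ∧ ∑' k, (w k * x (σ k)) ^ 2 ≤ ‖x‖ ^ 2 := by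
  have h1 : HasSum (fun k => x (σ k) ^ 2) (‖x‖ ^ 2) :=
    (Equiv.hasSum_iff σ (f := fun k => x k ^ 2)).2 (lp_two_norm_sq x)
  have h2 : ∀ k, (w k * x (σ k)) ^ 2 ≤ x (σ k) ^ 2 := by
    intro k
    have h3 : w k ^ 2 ≤ 1 := (sq_le_one_iff_abs_le_one _).2 (hw k)
    rw [mul_pow]
    exact mul_le_of_le_one_left (sq_nonneg _) h3
  have h3 : Summable fun k => (w k * x (σ k)) ^ 2 :=
    Summable.of_nonneg_of_le (fun k => sq_nonneg _) h2 h1.summable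
  exact ⟨h3, hasSum_le h2 h3.hasSum h1⟩

/-- The weighted permutation operator `x ↦ (w k * x (σ k))ₖ` on `ℓ²(ι)`. -/
noncomputable def weightedPerm (w : ι → ℝ) (hw : ∀ k, |w k| ≤ 1) (σ : Equiv.Perm ι) :
    lp (fun _ : ι => ℝ) 2 →L[ℝ] lp (fun _ : ι => ℝ) 2 :=
  LinearMap.mkContinuous
    { toFun := fun x => ⟨fun k => w k * x (σ k), memℓp_two_iff.2 (summable_weighted_comp hw σ x).1⟩
      map_add' := fun x y => by
        ext k
        exact mul_add _ _ _
      map_smul' := fun c x => by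
        ext k
        simp [mul_left_comm] } 1 (fun x => by
      rw [one_mul]
      refine (sq_le_sq₀ (norm_nonneg _) (norm_nonneg _)).1 ?_
      rw [← (lp_two_norm_sq _).tsum_eq]
      exact (summable_weighted_comp hw σ x).2)

theorem weightedPerm_apply (w : ι → ℝ) (hw : ∀ k, |w k| ≤ 1) (σ : Equiv.Perm ι)
    (x : lp (fun _ : ι => ℝ) 2) (k : ι) : weightedPerm w hw σ x k = w k * x (σ k) := rfl

theorem isSymmContraction_weightedPerm {w : ι → ℝ} (hw : ∀ k, |w k| ≤ 1) {σ : Equiv.Perm ι}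
    (hσ : ∀ k, σ (σ k) = k) (hwσ : ∀ k, w (σ k) = w k) :
    IsSymmContraction (weightedPerm w hw σ) where
  symm x y := by
    rw [lp.inner_eq_tsum, lp.inner_eq_tsum, ← Equiv.tsum_eq σ]
    refine tsum_congr fun k => ?_
    simp only [weightedPerm_apply, hσ, hwσ, RCLike.inner_apply, conj_trivial]
    ring
  norm_le x := by
    refine (sq_le_sq₀ (norm_nonneg _) (norm_nonneg _)).1 ?_
    rw [← (lp_two_norm_sq _).tsum_eq]
    exact (summable_weighted_comp hw σ x).2

/-- The sequences whose coordinates of index at least `m` vanish. -/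
def initialCoords (idx : ι → ℕ) (m : ℕ) : Submodule ℝ (lp (fun _ : ι => ℝ) 2) where
  carrier := {x | ∀ k, m ≤ idx k → x k = 0}
  add_mem' := fun {x y} hx hy k hk => by simp [hx k hk, hy k hk]
  zero_mem' := fun k _ => rfl
  smul_mem' := fun c x hx k hk => by simp [hx k hk]

theorem initialCoords_mono (idx : ι → ℕ) : Monotone (initialCoords idx) :=
  fun _ _ h _ hx k hk => hx k (h.trans hk)

theorem weightedPerm_mem_initialCoords {w : ι → ℝ} (hw : ∀ k, |w k| ≤ 1) {σ : Equiv.Perm ι}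
    {idx : ι → ℕ} {m : ℕ} (hσ : ∀ k, m ≤ idx k → m ≤ idx (σ k)) {x : lp (fun _ : ι => ℝ) 2}
    (hx : x ∈ initialCoords idx m) : weightedPerm w hw σ x ∈ initialCoords idx m := fun k hk => by
  rw [weightedPerm_apply, hx _ (hσ k hk), mul_zero]

/-- Transport of a chain along a linear isometry. -/
theorem IsQuadraticChain.map {E F : Type} [NormedAddCommGroup E] [InnerProductSpace ℝ E]
    [NormedAddCommGroup F] [InnerProductSpace ℝ F] {q Δ η : ℝ} {R₁ R₂ : E →L[ℝ] E} {b xs : E}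
    {K H : ℕ → Submodule ℝ E} (h : IsQuadraticChain q Δ η R₁ R₂ b xs K H) (Φ : F ≃ₗᵢ[ℝ] E) :
    ∃ (R₁ R₂ : F →L[ℝ] F) (b xs : F) (K H : ℕ → Submodule ℝ F), IsQuadraticChain q Δ η R₁ R₂ b xs K H := by
  let T : (E →L[ℝ] E) → (F →L[ℝ] F) := fun R =>
    (Φ.symm : E →L[ℝ] F).comp (R.comp (Φ : F →L[ℝ] E))
  have hT : ∀ R x, Φ (T R x) = R (Φ x) := fun R x => by simp [T]
  have hTc : ∀ R, IsSymmContraction R → IsSymmContraction (T R) := fun R hR =>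
    ⟨fun x y => by rw [← Φ.inner_map_map, ← Φ.inner_map_map, hT, hT, hR.symm],
      fun x => by rw [← Φ.norm_map, ← Φ.norm_map, hT]; exact hR.norm_le _⟩
  refine ⟨T R₁, T R₂, Φ.symm b, Φ.symm xs, fun s => (K s).comap (Φ : F →ₗ[ℝ] E),
    fun s => (H s).comap (Φ : F →ₗ[ℝ] E), hTc _ h.contraction₁, hTc _ h.contraction₂,
    fun s => Submodule.comap_mono (h.le_odd s), fun s => Submodule.comap_mono (h.le_even s),
    fun s x hx => ?_, fun s x hx => ?_, ?_, ?_, ?_, fun s x hx => ?_⟩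
  · change Φ (T R₁ x) ∈ H s
    rw [hT]
    exact h.maps₁ s _ hx
  · change Φ (T R₂ x) ∈ K s
    rw [hT]
    exact h.maps₂ s _ hx
  · change Φ (Φ.symm b) ∈ H 0
    simpa using h.source_mem
  · apply Φ.injective
    simp only [map_sub, map_smul, hT, LinearIsometryEquiv.apply_symm_apply, h.equation]
  · simpa using h.norm_le
  · have := h.dist_ge s (Φ x) hx
    rwa [← Φ.norm_map, map_sub, LinearIsometryEquiv.apply_symm_apply]

/-- Exchanges `2j` and `2j + 1`. -/
def evenSwap (k : ℕ) : ℕ := if k % 2 = 0 then k + 1 else k - 1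

/-- Fixes `0` and exchanges `2j + 1` and `2j + 2`. -/
def oddSwap (k : ℕ) : ℕ := if k = 0 then 0 else if k % 2 = 1 then k + 1 else k - 1

theorem evenSwap_evenSwap (k : ℕ) : evenSwap (evenSwap k) = k := by grind [evenSwap]

theorem oddSwap_oddSwap (k : ℕ) : oddSwap (oddSwap k) = k := by grind [oddSwap]

theorem le_evenSwap {s k : ℕ} (h : 2 * s ≤ k) : 2 * s ≤ evenSwap k := by grind [evenSwap]

theorem le_oddSwap {s k : ℕ} (h : 2 * s + 1 ≤ k) : 2 * s + 1 ≤ oddSwap k := by grind [oddSwap]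

/-- For `k ≠ 0` the two swaps send `k` to its two neighbours `k - 1` and `k + 1`, in an order
depending on parity, so this is the recurrence solved by `q ^ k`. At `k = 0` it fails, which is
where the source sits. -/
theorem geometric_swap {q : ℝ} (hq : q ≠ 0) {k : ℕ} (hk : k ≠ 0) :
    (q + q⁻¹) * q ^ k - q ^ oddSwap k - q ^ evenSwap k = 0 := by
  obtain ⟨j, rfl⟩ : ∃ j, k = j + 1 := ⟨k - 1, by omega⟩
  have h : (oddSwap (j + 1) = j + 2 ∧ evenSwap (j + 1) = j) ∨
      (oddSwap (j + 1) = j ∧ evenSwap (j + 1) = j + 2) := by grind [oddSwap, evenSwap]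
  rcases h with ⟨h1, h2⟩ | ⟨h1, h2⟩ <;> rw [h1, h2] <;> field_simp <;> ring

/-- A chain on `ℓ²(ι)` from involutions of the index set that act as `oddSwap` and `evenSwap`, the
former up to a boundary weight. -/
theorem isQuadraticChain_lp {q Δ η : ℝ} (hq0 : 0 < q) (hq1 : q < 1) (hΔ : 0 < Δ) {idx : ι → ℕ}
    {w : ι → ℝ} (hw : ∀ k, |w k| ≤ 1) {σ₁ σ₂ : Equiv.Perm ι} (h₁ : ∀ k, σ₁ (σ₁ k) = k)
    (h₂ : ∀ k, σ₂ (σ₂ k) = k) (hwσ : ∀ k, w (σ₁ k) = w k)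
    (hle : ∀ s k, 2 * s + 1 ≤ idx k → 2 * s + 1 ≤ idx (σ₁ k))
    (hσ₁ : ∀ k, w k * q ^ idx (σ₁ k) = q ^ oddSwap (idx k))
    (hσ₂ : ∀ k, idx (σ₂ k) = evenSwap (idx k))
    (hsum : Summable fun k => q ^ (2 * idx k))
    (hnorm : (1 - q ^ 2) * ∑' k, q ^ (2 * idx k) ≤ 1)
    (htail : ∀ s, q ^ (4 * s) - η ≤
      (1 - q ^ 2) * ∑' k, if 2 * s ≤ idx k then q ^ (2 * idx k) else 0) :
    ∃ (R₁ R₂ : lp (fun _ : ι => ℝ) 2 →L[ℝ] lp (fun _ : ι => ℝ) 2) (b xs : lp (fun _ : ι => ℝ) 2)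
      (K H : ℕ → Submodule ℝ (lp (fun _ : ι => ℝ) 2)), IsQuadraticChain q Δ η R₁ R₂ b xs K H := by
  have hD : 0 ≤ Δ * (1 - q ^ 2) := by
    have : q ^ 2 ≤ 1 := by nlinarith
    have : 0 ≤ 1 - q ^ 2 := by linarith
    positivity
  have hsq : ∀ k, (√(Δ * (1 - q ^ 2)) * q ^ idx k) ^ 2 = Δ * (1 - q ^ 2) * q ^ (2 * idx k) := by
    intro k
    rw [mul_pow, Real.sq_sqrt hD, ← pow_mul, mul_comm (idx k)]
  -- The factor `√(Δ(1 - q²))` normalises the full geometric sequence to squared norm `Δ`.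
  let xs : lp (fun _ : ι => ℝ) 2 := ⟨fun k => √(Δ * (1 - q ^ 2)) * q ^ idx k,
    memℓp_two_iff.2 (by simp_rw [hsq]; exact hsum.mul_left _)⟩
  have hxs : ∀ k, xs k = √(Δ * (1 - q ^ 2)) * q ^ idx k := fun k => rfl
  have hw' : ∀ k : ι, |(1 : ℝ)| ≤ 1 := by simp
  refine ⟨weightedPerm w hw σ₁, weightedPerm (fun _ => 1) hw' σ₂,
    (q + q⁻¹) • xs - weightedPerm w hw σ₁ xs - weightedPerm (fun _ => 1) hw' σ₂ xs, xs,
    fun s => initialCoords idx (2 * s), fun s => initialCoords idx (2 * s + 1),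
    isSymmContraction_weightedPerm hw h₁ hwσ,
    isSymmContraction_weightedPerm hw' h₂ fun _ => rfl,
    fun s => initialCoords_mono _ (by omega), fun s => initialCoords_mono _ (by omega),
    fun s x hx => weightedPerm_mem_initialCoords hw (hle s) hx,
    fun s x hx => weightedPerm_mem_initialCoords hw' (fun k hk => ?_) hx, fun k hk => ?_, rfl, ?_,
    fun s x hx => ?_⟩
  · rw [hσ₂]
    exact le_evenSwap hk
  -- The source is defined as the residual of the equation; the recurrence makes it vanish away from
  -- index `0`.
  · have h := geometric_swap hq0.ne' (k := idx k) (by omega)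
    have h3 : ((q + q⁻¹) • xs - weightedPerm w hw σ₁ xs - weightedPerm (fun _ => 1) hw' σ₂ xs) k =
        √(Δ * (1 - q ^ 2)) *
          ((q + q⁻¹) * q ^ idx k - w k * q ^ idx (σ₁ k) - q ^ idx (σ₂ k)) := by
      simp only [lp.coeFn_sub, lp.coeFn_smul, Pi.sub_apply, Pi.smul_apply, smul_eq_mul,
        weightedPerm_apply, hxs]
      ring
    rw [h3, hσ₁, hσ₂, h, mul_zero]
  · rw [← (lp_two_norm_sq xs).tsum_eq]
    simp_rw [hxs, hsq]
    rw [tsum_mul_left]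
    nlinarith
  · calc
      _ ≤ Δ * ((1 - q ^ 2) * ∑' k, if 2 * s ≤ idx k then q ^ (2 * idx k) else 0) := by
        gcongr
        exact htail s
      _ = ∑' k, Δ * (1 - q ^ 2) * (if 2 * s ≤ idx k then q ^ (2 * idx k) else 0) := by
        rw [tsum_mul_left, mul_assoc]
      _ ≤ ∑' k, (x - xs) k ^ 2 := by
        refine Summable.tsum_le_tsum (fun k => ?_) ?_ (lp_two_norm_sq _).summable
        · split_ifs with hk
          · rw [← hsq, lp.coeFn_sub, Pi.sub_apply, hx k hk, zero_sub, neg_sq, hxs]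
          · simp only [mul_zero]
            positivity
        · refine (Summable.of_nonneg_of_le (fun k => ?_) (fun k => ?_) hsum).mul_left _
          · split_ifs <;> positivity
          · split_ifs
            · exact le_rfl
            · positivity
      _ = _ := (lp_two_norm_sq _).tsum_eq

theorem exists_isQuadraticChain_ellTwo {q Δ : ℝ} (hq0 : 0 < q) (hq1 : q < 1) (hΔ : 0 < Δ) :
    ∃ (R₁ R₂ : EllTwo →L[ℝ] EllTwo) (b xs : EllTwo) (K H : ℕ → Submodule ℝ EllTwo),
      IsQuadraticChain q Δ 0 R₁ R₂ b xs K H := by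
  have hq2 : q ^ 2 < 1 := by nlinarith
  have hgeom : HasSum (fun k : ℕ => q ^ (2 * k)) (1 - q ^ 2)⁻¹ := by
    simp_rw [pow_mul]
    exact hasSum_geometric_of_lt_one (by positivity) hq2
  have hne : 1 - q ^ 2 ≠ 0 := by linarith
  refine isQuadraticChain_lp (idx := fun k : ℕ => k) (w := fun _ => 1) hq0 hq1 hΔ (by simp)
    (σ₁ := ⟨oddSwap, oddSwap, oddSwap_oddSwap, oddSwap_oddSwap⟩)
    (σ₂ := ⟨evenSwap, evenSwap, evenSwap_evenSwap, evenSwap_evenSwap⟩)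
    oddSwap_oddSwap evenSwap_evenSwap (fun _ => rfl) (fun s k => le_oddSwap) (fun k => one_mul _)
    (fun k => rfl) hgeom.summable ?_ fun s => ?_
  · rw [hgeom.tsum_eq, mul_inv_cancel₀ hne]
  · have h : HasSum (fun k : ℕ => if 2 * s ≤ k then q ^ (2 * k) else 0)
        (q ^ (4 * s) * (1 - q ^ 2)⁻¹) := by
      rw [← hasSum_nat_add_iff' (2 * s)]
      have h0 : ∑ k ∈ Finset.range (2 * s), (if 2 * s ≤ k then q ^ (2 * k) else 0) = 0 :=
        Finset.sum_eq_zero fun k hk => if_neg (by simpa using hk)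
      rw [h0, sub_zero]
      refine (hgeom.mul_left (q ^ (4 * s))).congr_fun fun k => ?_
      simp only [le_add_iff_nonneg_left, zero_le, if_true]
      rw [← pow_add]
      congr 1
      ring
    rw [h.tsum_eq, sub_zero, mul_left_comm, mul_inv_cancel₀ hne, mul_one]

theorem exists_isQuadraticChain_euclidean {q Δ : ℝ} (hq0 : 0 < q) (hq1 : q < 1) (hΔ : 0 < Δ) {N : ℕ}
    (hN : 0 < N) :
    ∃ (R₁ R₂ : EuclideanSpace ℝ (Fin (2 * N)) →L[ℝ] EuclideanSpace ℝ (Fin (2 * N)))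
      (b xs : EuclideanSpace ℝ (Fin (2 * N)))
      (K H : ℕ → Submodule ℝ (EuclideanSpace ℝ (Fin (2 * N)))),
      IsQuadraticChain q Δ (q ^ (4 * N)) R₁ R₂ b xs K H := by
  let f₁ : Fin (2 * N) → Fin (2 * N) := fun k =>
    if h : oddSwap k < 2 * N then ⟨oddSwap k, h⟩ else k
  let f₂ : Fin (2 * N) → Fin (2 * N) := fun k => ⟨evenSwap k, by grind [evenSwap]⟩
  have hf₁ : ∀ k, f₁ (f₁ k) = k := by
    intro k
    by_cases h : oddSwap k < 2 * N
    · simp [f₁, h, oddSwap_oddSwap]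
    · simp [f₁, h]
  have hf₂ : ∀ k, f₂ (f₂ k) = k := fun k => by simp [f₂, evenSwap_evenSwap]
  have hsum : ∀ m ≤ 2 * N, (1 - q ^ 2) *
      ∑' k : Fin (2 * N), (if m ≤ (k : ℕ) then q ^ (2 * (k : ℕ)) else 0) =
        q ^ (2 * m) - q ^ (4 * N) := by
    intro m hm
    rw [tsum_fintype, Fin.sum_univ_eq_sum_range (fun k => if m ≤ k then q ^ (2 * k) else 0)]
    induction hm using Nat.decreasingInduction with
    | self =>
      rw [Finset.sum_eq_zero fun k hk => if_neg (by simpa using hk), mul_zero]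
      rw [show 4 * N = 2 * (2 * N) by ring, sub_self]
    | of_succ m hm ih =>
      have h : ∀ k, (if m ≤ k then q ^ (2 * k) else 0) =
          (if m + 1 ≤ k then q ^ (2 * k) else 0) + if m = k then q ^ (2 * m) else 0 := by
        intro k
        grind
      simp_rw [h]
      rw [Finset.sum_add_distrib, mul_add, ih, Finset.sum_ite_eq, if_pos (by simpa using hm)]
      ring
  -- At the last index `2N - 1` the odd link would leave the range. It is replaced by a fixed point
  -- of weight `q`, since `q * q ^ (2N - 1) = q ^ (2N)`: the truncated geometric sequence still
  -- solves the equation exactly. Only the missing tail `q ^ (4N)` of the norm is lost.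
  have hchain := isQuadraticChain_lp (idx := fun k : Fin (2 * N) => (k : ℕ)) (η := q ^ (4 * N))
    (w := fun k => if oddSwap k < 2 * N then 1 else q) hq0 hq1 hΔ
    (fun k => by split_ifs <;> simp [abs_of_pos hq0, hq1.le])
    (σ₁ := ⟨f₁, f₁, hf₁, hf₁⟩) (σ₂ := ⟨f₂, f₂, hf₂, hf₂⟩) hf₁ hf₂ ?_ ?_ ?_ (fun k => rfl)
    Summable.of_finite ?_ ?_
  · obtain ⟨R₁, R₂, b, xs, K, H, h⟩ := hchain
    exact h.map (lpPiLpₗᵢ (fun _ : Fin (2 * N) => ℝ) ℝ).symm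
  · intro k
    change (if oddSwap (f₁ k) < 2 * N then 1 else q) = _
    by_cases h : oddSwap k < 2 * N
    · simp [f₁, h, oddSwap_oddSwap]
    · simp [f₁, h]
  · intro s k hk
    change _ ≤ ((f₁ k : Fin _) : ℕ)
    by_cases h : oddSwap k < 2 * N
    · simpa [f₁, h] using le_oddSwap hk
    · simpa [f₁, h] using hk
  · intro k
    change _ * q ^ ((f₁ k : Fin _) : ℕ) = _
    by_cases h : oddSwap k < 2 * N
    · simp [f₁, h]
    · have : oddSwap k = k + 1 := by grind [oddSwap]
      simp only [f₁, h, dite_false, if_false]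
      rw [this, pow_succ']
  · have := hsum 0 (by omega)
    simp only [zero_le, if_true, mul_zero, pow_zero] at this
    rw [this]
    linarith [pow_pos hq0 (4 * N)]
  · intro s
    rcases le_or_gt (2 * s) (2 * N) with h | h
    · rw [hsum _ h]
      rw [show 2 * (2 * s) = 4 * s by ring]
    -- Beyond the end of the chain the claimed lower bound is not positive.
    · have h1 : q ^ (4 * s) ≤ q ^ (4 * N) := pow_le_pow_of_le_one hq0.le hq1.le (by omega)
      have h2 : 0 ≤ 1 - q ^ 2 := by nlinarith
      have h3 : 0 ≤ ∑' k : Fin (2 * N), (if 2 * s ≤ (k : ℕ) then q ^ (2 * (k : ℕ)) else 0) :=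
        tsum_nonneg fun k => by split_ifs <;> positivity
      nlinarith [mul_nonneg h2 h3]

end Chain

/-! ### Hard instances for the three terms of the bound -/

section HardInstance

/-- There is an instance on `E` for which every algorithm needs at least `ψ log (μΔ / ε)` rounds to
reach the accuracy `ε`, for all `ε ≤ μΔ / 16` that are not smaller than `ημΔ / 2`. -/
def HasHardInstance (E : Type) [NormedAddCommGroup E] [InnerProductSpace ℝ E] [CompleteSpace E]
    [MeasurableSpace E] (n : ℕ) (L μ Δ ω η ψ : ℝ) : Prop :=
  ∃ (f : Fin n → E → ℝ) (C : CompressorFamily n E),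
    FunctionClass L μ Δ 0 f ∧ C.IsUnbiased ω ∧ C.IsIndependent ∧
    ∀ A : LinearSpanningAlgorithm.{u} f C, ∀ ε : ℝ, 0 < ε → ε ≤ 1 / 16 * (μ * Δ) →
      μ * Δ / 2 * η ≤ ε →
      ENNReal.ofReal (ψ * Real.log (μ * Δ / ε)) ≤ (A.complexity ε : ℝ≥0∞)

variable {E : Type} [NormedAddCommGroup E] [InnerProductSpace ℝ E] [CompleteSpace E]
  [MeasurableSpace E] {n : ℕ} {L μ Δ ω η : ℝ}

theorem HasHardInstance.mono {ψ ψ' : ℝ} (h : HasHardInstance.{u} E n L μ Δ ω η ψ) (hψ : ψ' ≤ ψ) :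
    HasHardInstance.{u} E n L μ Δ ω η ψ' := by
  obtain ⟨f, C, hf, hC, hi, hA⟩ := h
  refine ⟨f, C, hf, hC, hi, fun A ε hε hε1 hε2 => le_trans ?_ (hA A ε hε hε1 hε2)⟩
  refine ENNReal.ofReal_le_ofReal (mul_le_mul_of_nonneg_right hψ (Real.log_nonneg ?_))
  rw [le_div_iff₀ hε]
  linarith

variable [BorelSpace E]

/-- Weighted AM-GM for `q ^ 4` and `1` with weights `p` and `1 - p`; it turns the decay per round
into the rate `4 p log q⁻¹`. -/
theorem exp_neg_mul_le {p q : ℝ} (hp0 : 0 ≤ p) (hp1 : p ≤ 1) (hq : 0 < q) :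
    Real.exp (-(p * (4 * Real.log q⁻¹))) ≤ 1 - p * (1 - q ^ 4) := by
  have h := Real.geom_mean_le_arith_mean2_weighted (w₁ := p) (w₂ := 1 - p) (p₁ := q ^ 4) (p₂ := 1)
    hp0 (by linarith) (by positivity) zero_le_one (by ring)
  rw [Real.one_rpow, mul_one, Real.rpow_def_of_pos (by positivity), Real.log_pow] at h
  have h1 : -(p * (4 * Real.log q⁻¹)) = ((4 : ℕ) : ℝ) * Real.log q * p := by
    rw [Real.log_inv]
    push_cast
    ring
  rw [h1]
  linarith

theorem sum_fin_two_groups {F : Type*} [AddCommGroup F] {m : ℕ} (hm : 2 * m ≤ n) (x y z : F) :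
    ∑ i : Fin n, (if (i : ℕ) < m then x else if (i : ℕ) < 2 * m then y else z) =
      m • x + m • y + (n - 2 * m) • z := by
  rw [Fin.sum_univ_eq_sum_range (fun k => if k < m then x else if k < 2 * m then y else z)]
  obtain ⟨r, rfl⟩ : ∃ r, n = m + m + r := ⟨n - 2 * m, by omega⟩
  rw [Finset.sum_range_add, Finset.sum_range_add]
  have h1 : ∀ k ∈ Finset.range m, (if k < m then x else if k < 2 * m then y else z) = x :=
    fun k hk => if_pos (by simpa using hk)
  have h2 : ∀ k ∈ Finset.range m,
      (if m + k < m then x else if m + k < 2 * m then y else z) = y := fun k hk => by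
    have := Finset.mem_range.1 hk
    rw [if_neg (by omega), if_pos (by omega)]
  have h3 : ∀ k ∈ Finset.range r,
      (if m + m + k < m then x else if m + m + k < 2 * m then y else z) = z := fun k hk => by
    rw [if_neg (by omega), if_neg (by omega)]
  rw [Finset.sum_congr rfl h1, Finset.sum_congr rfl h2, Finset.sum_congr rfl h3]
  simp only [Finset.sum_const, Finset.card_range]
  congr 2
  omega

/-- The hypothesis `hq` is the condition that the average of the local gradients vanishes at the
chain solution `xs`. The event `B` contains every round in which some worker of the first group gets
a message through. -/
theorem hasHardInstance_of_chain {m : ℕ} {p q : ℝ} (hm0 : 0 < m) (hm : 2 * m ≤ n) (hμ : 0 < μ)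
    (hμL : μ ≤ L) (hω : 0 ≤ ω) (hη : 0 ≤ η) (hq0 : 0 < q) (hq1 : q < 1)
    (hq : 2 * n * μ * q = (L - μ) * m * (1 - q) ^ 2)
    {B : Set (coinCompressor n E ω hω).Seed} (hB : MeasurableSet B) (hp0 : 0 < p) (hp1 : p ≤ 1)
    (hpB : (coinCompressor n E ω hω).law.real B ≤ p)
    (hfail : ∀ i : Fin n, (i : ℕ) < m → ∀ s ∉ B, ∀ x, (coinCompressor n E ω hω).op i s x = 0)
    {R₁ R₂ : E →L[ℝ] E} {b xs : E} {K H : ℕ → Submodule ℝ E}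
    (hc : IsQuadraticChain q Δ η R₁ R₂ b xs K H) :
    HasHardInstance.{u} E n L μ Δ ω η (1 / (8 * (p * Real.log q⁻¹))) := by
  have hn : 0 < n := by omega
  let R : Fin n → E →L[ℝ] E := fun i =>
    if (i : ℕ) < m then R₁ else if (i : ℕ) < 2 * m then R₂ else .id ℝ E
  let c : Fin n → E := fun i => if (i : ℕ) < m then ((L - μ) / 2) • b else 0
  have hR : ∀ i, IsSymmContraction (R i) := by
    intro i
    simp only [R]
    split_ifs
    exacts [hc.contraction₁, hc.contraction₂, .id]
  have hgrad : ∀ i x, gradient (quadratic L μ (R i) (c i)) x = quadraticGrad L μ (R i) (c i) x :=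
    fun i x => (hasGradientAt_quadratic (hR i) hμ.le hμL (c i) x).gradient
  have hxs : ∑ i, quadraticGrad L μ (R i) (c i) xs = 0 := by
    have h1 : ∀ i : Fin n, quadraticGrad L μ (R i) (c i) xs =
        if (i : ℕ) < m then quadraticGrad L μ R₁ (((L - μ) / 2) • b) xs
        else if (i : ℕ) < 2 * m then quadraticGrad L μ R₂ 0 xs
        else quadraticGrad L μ (.id ℝ E) 0 xs := by
      intro i
      simp only [R, c]
      split_ifs <;> rfl
    simp_rw [h1]
    rw [sum_fin_two_groups hm, ← hc.equation]
    -- This is `hq` divided by `2q`: the diagonal coefficient of the summed Hessian matches that of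
    -- the chain equation.
    have h2 : (n : ℝ) * μ + (L - μ) * m = m * ((L - μ) / 2) * (q + q⁻¹) := by
      field_simp
      linarith
    simp only [quadraticGrad, ← Nat.cast_smul_eq_nsmul ℝ]
    rw [Nat.cast_sub hm]
    push_cast
    rw [id_eq, sub_self]
    have h3 : ((n : ℝ) * μ + (L - μ) * m - m * ((L - μ) / 2) * (q + q⁻¹)) • xs = 0 := by
      rw [h2, sub_self, zero_smul]
    refine Eq.trans ?_ h3
    module
  refine ⟨fun i => quadratic L μ (R i) (c i), coinCompressor n E ω hω,
    functionClass_quadratic hn hμ.le hμL hR hxs hc.norm_le, coinCompressor_isUnbiased hω,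
    coinCompressor_isIndependent hω, fun A ε hε hε1 hε2 => ?_⟩
  have hlog : 0 < Real.log q⁻¹ := Real.log_pos ((one_lt_inv₀ hq0).2 hq1)
  have hH : Monotone H := monotone_nat_of_le_succ fun s => (hc.le_even s).trans (hc.le_odd _)
  have hrw : 1 / (8 * (p * Real.log q⁻¹)) = 1 / (2 * (p * (4 * Real.log q⁻¹))) := by
    congr 1
    ring
  rw [hrw]
  -- A success reveals two coordinates, each worth a factor `q²` in the squared distance.
  refine A.ofReal_log_le_complexity hB (θ := q ^ 4) hp1 hpB (by positivity)
    (pow_le_one₀ hq0.le hq1.le) (by positivity) (exp_neg_mul_le hp0.le hp1 hq0) hη hε hε1 hε2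
    fun t w => ?_
  have hmem := A.output_mem_of_successes B {i | (i : ℕ) < m} hc.le_odd hc.le_even
    (fun i hi s x hx => ?_) (fun i hi s x hx => ?_) (coinCompressor_op_mem_span hω) hfail t w
  · have h1 := globalObjective_quadratic_sub_iInf_ge hn hμ.le hμL hR hxs (A.output t w)
    have h2 := mul_le_mul_of_nonneg_left (hc.dist_ge _ _ hmem) (half_pos hμ).le
    rw [pow_mul] at h2
    linarith
  · rw [Set.mem_ofPred_eq] at hi
    rw [hgrad]
    simp only [R, c, if_neg hi]
    split_ifs
    · exact quadraticGrad_mem hx (hc.maps₂ s x hx) (zero_mem _)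
    · exact quadraticGrad_mem hx hx (zero_mem _)
  · rw [Set.mem_ofPred_eq] at hi
    rw [hgrad]
    simp only [R, c, if_pos hi]
    exact quadraticGrad_mem hx (hc.maps₁ s x hx)
      (Submodule.smul_mem _ _ (hH (Nat.zero_le s) hc.source_mem))

/-- An instance in which a single worker has to communicate once. -/
theorem hasHardInstance_single_message (hn : 0 < n) (hμ : 0 < μ) (hμL : μ ≤ L) (hω : 0 ≤ ω)
    (hη : 0 ≤ η) {xs : E} (hxsΔ : ‖xs‖ ^ 2 = Δ) :
    HasHardInstance.{u} E n L μ Δ ω η (ω / 2) := by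
  let i₀ : Fin n := ⟨0, hn⟩
  let b : Fin n → E := fun i => if i = i₀ then ((n : ℝ) * μ) • xs else 0
  have hR : ∀ _ : Fin n, IsSymmContraction (ContinuousLinearMap.id ℝ E) := fun _ => .id
  have hgrad : ∀ i x, gradient (quadratic L μ (.id ℝ E) (b i)) x =
      quadraticGrad L μ (.id ℝ E) (b i) x :=
    fun i x => (hasGradientAt_quadratic .id hμ.le hμL (b i) x).gradient
  have hxs : ∑ i, quadraticGrad L μ (.id ℝ E) (b i) xs = 0 := by
    simp [quadraticGrad, b, Finset.sum_sub_distrib, ← Nat.cast_smul_eq_nsmul ℝ, smul_smul]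
  refine ⟨fun i => quadratic L μ (.id ℝ E) (b i), coinCompressor n E ω hω,
    functionClass_quadratic hn hμ.le hμL hR hxs hxsΔ.le, coinCompressor_isUnbiased hω,
    coinCompressor_isIndependent hω, fun A ε hε hε1 hε2 => ?_⟩
  rcases hω.eq_or_lt with rfl | hω0
  · simp
  have hrw : ω / 2 = 1 / (2 * (1 / ω)) := by field_simp
  -- The probability `ω / (1 + ω)` of silence is the inverse of `1 + 1 / ω ≤ exp (1 / ω)`.
  have hexp : Real.exp (-(1 / ω)) ≤ 1 - 1 / (1 + ω) * (1 - 0) := by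
    have h1 := Real.add_one_le_exp (1 / ω)
    have h2 : 1 - 1 / (1 + ω) * (1 - 0) = (1 / ω + 1)⁻¹ := by
      field_simp
      ring
    rw [h2, Real.exp_neg]
    gcongr
  -- Until worker `i₀` first gets through, the server knows only `0`; afterwards nothing is claimed.
  -- This matches `θ = 0`.
  let K : ℕ → Submodule ℝ E := fun s => if s = 0 then ⊥ else ⊤
  rw [hrw]
  refine A.ofReal_log_le_complexity (measurableSet_coinSuccess hω i₀) (θ := 0) (p := 1 / (1 + ω))
    ?_ (law_real_coinSuccess hω i₀).le le_rfl zero_le_one (by positivity) hexp hη hε hε1 hε2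
    fun t w => ?_
  · rw [div_le_one (by positivity)]
    linarith
  have hmem := A.output_mem_of_successes (coinSuccess hω i₀) {i₀} (K := K) (H := fun _ => ⊤)
    (fun s => le_top) (fun s => by simp [K]) (fun i hi s x hx => ?_) (fun i hi s x hx => trivial)
    (coinCompressor_op_mem_span hω)
    (fun i hi s hs x => by rw [Set.mem_singleton_iff.1 hi]; exact coinCompressor_op_eq_zero hω hs x)
    t w
  · have h1 := globalObjective_quadratic_sub_iInf_ge hn hμ.le hμL hR hxs (A.output t w)
    by_cases hs : A.successes (coinSuccess hω i₀) t w = 0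
    · rw [hs] at hmem ⊢
      have h2 : A.output t w = 0 := by simpa [K] using hmem
      rw [h2, zero_sub, norm_neg, hxsΔ] at h1
      rw [h2, pow_zero]
      have h3 : 0 ≤ μ * Δ / 2 * η := by rw [← hxsΔ]; positivity
      linarith
    · have h3 : 0 ≤ μ * Δ / 2 * η := by rw [← hxsΔ]; positivity
      have h4 : 0 ≤ μ / 2 * ‖A.output t w - xs‖ ^ 2 := by positivity
      rw [zero_pow hs]
      linarith
  · rw [hgrad]
    simp only [b, if_neg (show i ≠ i₀ from hi)]
    exact quadraticGrad_mem hx hx (zero_mem _)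

/-- The contraction factor `q` of a chain of condition number `1 + x`. -/
theorem exists_contraction_factor {x₀ x : ℝ} (hx₀ : 0 < x₀) (hx : x₀ ≤ x) :
    ∃ q : ℝ, 0 < q ∧ q < 1 ∧ 4 * q = x * (1 - q) ^ 2 ∧
      √x₀ / (√x₀ + 2) * √x / 2 ≤ 1 / Real.log q⁻¹ := by
  have hx0 : 0 < x := hx₀.trans_le hx
  -- With `s` the square root of the condition number, the root in `(0, 1)` is the classical `q = (s
  -- - 1) / (s + 1)`, for which `log q⁻¹ ≤ 2 / (s - 1)`.
  obtain ⟨s, hs⟩ : ∃ s, s = √(1 + x) := ⟨_, rfl⟩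
  have hs2 : s ^ 2 = 1 + x := by rw [hs, Real.sq_sqrt (by positivity)]
  have hs0 : 0 ≤ s := by rw [hs]; positivity
  have hs1 : 1 < s := by nlinarith
  have h1 : 0 < s - 1 := by linarith
  have hxs : x = (s - 1) * (s + 1) := by linarith
  have hq1 : (s - 1) / (s + 1) < 1 := by
    rw [div_lt_one (by positivity)]
    linarith
  refine ⟨(s - 1) / (s + 1), by positivity, hq1, ?_, ?_⟩
  · rw [hxs]
    field_simp
    ring
  · have hlog0 : 0 < Real.log ((s - 1) / (s + 1))⁻¹ :=
      Real.log_pos ((one_lt_inv₀ (by positivity)).2 hq1)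
    have hlog : Real.log ((s - 1) / (s + 1))⁻¹ ≤ 2 / (s - 1) := by
      refine (Real.log_le_sub_one_of_pos (by positivity)).trans (le_of_eq ?_)
      field_simp
      ring
    have h2 : (s - 1) / 2 ≤ 1 / Real.log ((s - 1) / (s + 1))⁻¹ := by
      rw [le_div_iff₀ hlog0]
      calc _ ≤ (s - 1) / 2 * (2 / (s - 1)) := by gcongr
        _ = 1 := by field_simp
    refine le_trans ?_ h2
    have hy : √x ^ 2 = x := Real.sq_sqrt hx0.le
    have hy0 : 0 < √x := Real.sqrt_pos.2 hx0
    have hmono : √x₀ / (√x₀ + 2) ≤ √x / (√x + 2) := by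
      have := Real.sqrt_le_sqrt hx
      rw [div_le_div_iff₀ (by positivity) (by positivity)]
      linarith
    have h3 : √x / (√x + 2) * √x ≤ s - 1 := by
      rw [div_mul_eq_mul_div, div_le_iff₀ (by positivity)]
      have h4 : s ≤ √x + 1 := by nlinarith
      nlinarith
    have := mul_le_mul_of_nonneg_right hmono hy0.le
    linarith

/-- The factor `q` is fixed before the space and `η`, so that one choice serves `ℓ²` and truncations
of every length. -/
theorem exists_forall_hasHardInstance {δ : ℝ} (hδ : 0 < δ) : ∃ a : ℝ, 0 < a ∧
    ∀ n : ℕ, 2 ≤ n → ∀ L μ Δ ω : ℝ, 0 < μ → μ ≤ L → 0 < Δ → 0 ≤ ω → (1 + δ ≤ L / μ ∨ δ ≤ ω) →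
      ∃ q : ℝ, 0 < q ∧ q < 1 ∧
        ∀ (E : Type) [NormedAddCommGroup E] [InnerProductSpace ℝ E] [CompleteSpace E]
          [MeasurableSpace E] [BorelSpace E] (η : ℝ), 0 ≤ η → η < 1 →
          (∃ (R₁ R₂ : E →L[ℝ] E) (b xs : E) (K H : ℕ → Submodule ℝ E),
            IsQuadraticChain q Δ η R₁ R₂ b xs K H) →
          HasHardInstance.{u} E n L μ Δ ω η (a * (ω + (1 + ω / √(n : ℝ)) * √(L / μ))) := by
  -- `r` satisfies `κ - 1 ≥ rκ` when `κ ≥ 1 + δ`; `x₀ = 2r/3` also allows for `⌊n/2⌋ ≥ n/3`; `c₀` is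
  -- the loss in the contraction factor. If `κ < 1 + δ` and `ω ≥ δ`, the whole sum is at most `c₁ω`.
  -- In `a`, `48 = 3 · 16` combines the three terms with the `16` of the chain bound.
  obtain ⟨r, hr⟩ : ∃ r, r = δ / (1 + δ) := ⟨_, rfl⟩
  have hr0 : 0 < r := by rw [hr]; positivity
  obtain ⟨x₀, hx₀⟩ : ∃ x₀, x₀ = 2 * r / 3 := ⟨_, rfl⟩
  have hx₀0 : 0 < x₀ := by rw [hx₀]; positivity
  obtain ⟨c₀, hc₀⟩ : ∃ c₀, c₀ = √x₀ / (√x₀ + 2) := ⟨_, rfl⟩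
  have hc₀0 : 0 < c₀ := by rw [hc₀]; positivity
  obtain ⟨c₁, hc₁⟩ : ∃ c₁, c₁ = 1 + (1 / δ + 1) * √(1 + δ) := ⟨_, rfl⟩
  have hc₁1 : 1 ≤ c₁ := by rw [hc₁]; linarith [show 0 ≤ (1 / δ + 1) * √(1 + δ) by positivity]
  obtain ⟨a, ha⟩ : ∃ a, a = min (c₀ * √x₀ / 48) (1 / (6 * c₁)) := ⟨_, rfl⟩
  have ha0 : 0 < a := by rw [ha]; positivity
  have ha1 : a * 48 ≤ c₀ * √x₀ := by
    rw [← le_div_iff₀ (by norm_num), ha]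
    exact min_le_left _ _
  have ha2 : a * c₁ ≤ 1 / 6 := by
    have : a ≤ 1 / (6 * c₁) := by rw [ha]; exact min_le_right _ _
    calc a * c₁ ≤ 1 / (6 * c₁) * c₁ := by gcongr
      _ = 1 / 6 := by field_simp
  have ha3 : a ≤ 1 / 6 := le_trans (by nlinarith) ha2
  refine ⟨a, ha0, fun n hn L μ Δ ω hμ hμL hΔ hω hκω => ?_⟩
  have hn0 : (0 : ℝ) < n := by positivity
  obtain ⟨κ, hκ⟩ : ∃ κ, κ = L / μ := ⟨_, rfl⟩
  have hκ1 : 1 ≤ κ := by rw [hκ, le_div_iff₀ hμ]; linarith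
  have hL : L = κ * μ := by rw [hκ]; field_simp
  rw [← hκ] at hκω ⊢
  have hsn : 1 ≤ √(n : ℝ) := Real.one_le_sqrt.2 (by exact_mod_cast (by omega : 1 ≤ n))
  have hsκ : 0 < √κ := by positivity
  have hexpand : ω + (1 + ω / √(n : ℝ)) * √κ = ω + √κ + ω * √κ / √(n : ℝ) := by ring
  rw [hexpand]
  -- the term `ω` dominates
  have single : a * (ω + √κ + ω * √κ / √(n : ℝ)) ≤ ω / 2 → ∃ q : ℝ, 0 < q ∧ q < 1 ∧
        ∀ (E : Type) [NormedAddCommGroup E] [InnerProductSpace ℝ E] [CompleteSpace E]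
          [MeasurableSpace E] [BorelSpace E] (η : ℝ), 0 ≤ η → η < 1 →
          (∃ (R₁ R₂ : E →L[ℝ] E) (b xs : E) (K H : ℕ → Submodule ℝ E),
            IsQuadraticChain q Δ η R₁ R₂ b xs K H) →
          HasHardInstance.{u} E n L μ Δ ω η (a * (ω + √κ + ω * √κ / √(n : ℝ))) := by
    refine fun hle => ⟨1 / 2, by norm_num, by norm_num, ?_⟩
    rintro E _ _ _ _ _ η hη hη1 ⟨R₁, R₂, b, xs, K, H, hc⟩
    -- Here the chain serves only to supply a nonzero vector, using `η < 1`; the value of `q` is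
    -- irrelevant.
    have h0 := hc.dist_ge 0 0 (zero_mem _)
    have hxs : 0 < ‖xs‖ := by
      rw [zero_sub, norm_neg, mul_zero, pow_zero] at h0
      have : 0 < Δ * (1 - η) := mul_pos hΔ (by linarith)
      exact norm_pos_iff.2 fun h => by rw [h, norm_zero] at h0; norm_num at h0; linarith
    refine (hasHardInstance_single_message (xs := (√Δ / ‖xs‖) • xs) (by omega) hμ hμL hω hη
      ?_).mono hle
    rw [norm_smul, Real.norm_of_nonneg (by positivity), div_mul_cancel₀ _ hxs.ne',
      Real.sq_sqrt hΔ.le]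
  -- the chain dominates
  have chain : ∀ (m : ℕ) (p : ℝ), 0 < m → 2 * m ≤ n → 0 < p → p ≤ 1 →
      ((p = 1 / (1 + ω) ∧ m = 1) ∨ p = 1) → x₀ ≤ 2 * (κ - 1) * m / n →
      a * (ω + √κ + ω * √κ / √(n : ℝ)) ≤ c₀ * √(2 * (κ - 1) * m / n) / (16 * p) →
      ∃ q : ℝ, 0 < q ∧ q < 1 ∧
        ∀ (E : Type) [NormedAddCommGroup E] [InnerProductSpace ℝ E] [CompleteSpace E]
          [MeasurableSpace E] [BorelSpace E] (η : ℝ), 0 ≤ η → η < 1 →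
          (∃ (R₁ R₂ : E →L[ℝ] E) (b xs : E) (K H : ℕ → Submodule ℝ E),
            IsQuadraticChain q Δ η R₁ R₂ b xs K H) →
          HasHardInstance.{u} E n L μ Δ ω η (a * (ω + √κ + ω * √κ / √(n : ℝ))) := by
    intro m p hm0 hm hp0 hp1 hp hx hle
    obtain ⟨q, hq0, hq1, hq, hlog⟩ := exists_contraction_factor hx₀0 hx
    refine ⟨q, hq0, hq1, ?_⟩
    rintro E _ _ _ _ _ η hη hη1 ⟨R₁, R₂, b, xs, K, H, hc⟩
    have hq' : 2 * n * μ * q = (L - μ) * m * (1 - q) ^ 2 := by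
      rw [hL]
      field_simp at hq
      linear_combination μ / 2 * hq
    have hψ : a * (ω + √κ + ω * √κ / √(n : ℝ)) ≤ 1 / (8 * (p * Real.log q⁻¹)) := by
      refine hle.trans ?_
      rw [← hc₀] at hlog
      calc _ = c₀ * √(2 * (κ - 1) * m / n) / 2 * (1 / (8 * p)) := by ring
        _ ≤ 1 / Real.log q⁻¹ * (1 / (8 * p)) := by gcongr
        _ = _ := by rw [div_mul_div_comm]; congr 1 <;> ring
    refine HasHardInstance.mono ?_ hψ
    rcases hp with ⟨hp, rfl⟩ | rfl
    · refine hasHardInstance_of_chain hm0 hm hμ hμL hω hη hq0 hq1 hq'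
        (measurableSet_coinSuccess hω ⟨0, by omega⟩) hp0 hp1
        (by rw [law_real_coinSuccess, hp]) (fun i hi s hs x => ?_) hc
      have hi0 : i = ⟨0, by omega⟩ := Fin.ext (by simpa using hi)
      rw [hi0]
      exact coinCompressor_op_eq_zero hω hs x
    -- With `p = 1` every round counts as a success, and only the number of communication rounds is
    -- exploited.
    · exact hasHardInstance_of_chain hm0 hm hμ hμL hω hη hq0 hq1 hq' MeasurableSet.univ
        one_pos le_rfl measureReal_le_one (fun i hi s hs => absurd trivial hs) hc
  by_cases hκδ : 1 + δ ≤ κ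
  · have hκr : r * κ ≤ κ - 1 := by
      rw [hr, div_mul_eq_mul_div, div_le_iff₀ (by positivity)]
      linarith
    -- If the mixed term is the largest, then `κ ≥ n`, so a chain on one pair of workers still has
    -- `x ≥ x₀`.
    by_cases hZ : ω ≤ ω * √κ / √(n : ℝ) ∧ √κ ≤ ω * √κ / √(n : ℝ)
    · have hω0 : 0 < ω := by
        refine hω.lt_of_ne fun h => ?_
        have := hZ.2
        rw [← h] at this
        simp at this
        linarith
      have hnκ : (n : ℝ) ≤ κ := by
        have h1 := hZ.1
        rw [le_div_iff₀ (by positivity)] at h1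
        exact (Real.sqrt_le_sqrt_iff (by positivity)).1 (le_of_mul_le_mul_left h1 hω0)
      have hx : x₀ * (κ / n) ≤ 2 * (κ - 1) * (1 : ℕ) / n := by
        rw [← mul_div_assoc]
        refine div_le_div_of_nonneg_right ?_ hn0.le
        push_cast
        rw [hx₀]
        nlinarith
      have hκn : 1 ≤ κ / n := by rwa [le_div_iff₀ hn0, one_mul]
      refine chain 1 (1 / (1 + ω)) one_pos (by omega) (by positivity) ?_ (.inl ⟨rfl, rfl⟩)
        (by nlinarith) ?_
      · rw [div_le_one (by positivity)]
        linarith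
      · have h1 := Real.sqrt_le_sqrt hx
        rw [Real.sqrt_mul hx₀0.le, Real.sqrt_div (by positivity)] at h1
        calc _ ≤ a * (3 * (ω * √κ / √(n : ℝ))) := by gcongr; linarith [hZ.1, hZ.2]
          _ = a * 48 * (√κ / √(n : ℝ)) * ω / 16 := by ring
          _ ≤ c₀ * √x₀ * (√κ / √(n : ℝ)) * (1 + ω) / 16 := by gcongr; linarith
          _ = c₀ * (√x₀ * (√κ / √(n : ℝ))) / (16 * (1 / (1 + ω))) := by field_simp
          _ ≤ _ := by gcongr
    · by_cases hXY : √κ ≤ ω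
      · have hZ' : ω * √κ / √(n : ℝ) ≤ ω := by
          by_contra! h
          exact hZ ⟨h.le, hXY.trans h.le⟩
        refine single ?_
        calc _ ≤ a * (3 * ω) := by gcongr; linarith
          _ ≤ 1 / 6 * (3 * ω) := by gcongr
          _ = ω / 2 := by ring
      · have hZ' : ω * √κ / √(n : ℝ) ≤ √κ := by
          by_contra! h
          exact hZ ⟨by linarith, h.le⟩
        have hm : (n : ℝ) ≤ 3 * (n / 2 : ℕ) := by exact_mod_cast (by omega : n ≤ 3 * (n / 2))
        have hx : x₀ * κ ≤ 2 * (κ - 1) * (n / 2 : ℕ) / n := by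
          rw [le_div_iff₀ hn0, hx₀]
          have h1 : r * κ * n ≤ (κ - 1) * n := by gcongr
          have h2 : (κ - 1) * n ≤ (κ - 1) * (3 * (n / 2 : ℕ)) := by
            gcongr
          linarith
        refine chain (n / 2) 1 (by omega) (by omega) one_pos le_rfl (.inr rfl) (by nlinarith) ?_
        have h1 := Real.sqrt_le_sqrt hx
        rw [Real.sqrt_mul hx₀0.le] at h1
        calc _ ≤ a * (3 * √κ) := by gcongr; linarith
          _ = a * 48 * √κ / (16 * 1) := by ring
          _ ≤ c₀ * √x₀ * √κ / (16 * 1) := by gcongr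
          _ = c₀ * (√x₀ * √κ) / (16 * 1) := by ring
          _ ≤ _ := by gcongr
  · have hωδ : δ ≤ ω := hκω.resolve_left hκδ
    have h1 : √κ ≤ √(1 + δ) := Real.sqrt_le_sqrt (not_le.1 hκδ).le
    have h2 : ω * √κ / √(n : ℝ) ≤ ω * √(1 + δ) :=
      (div_le_self (by positivity) hsn).trans (by gcongr)
    have h3 : √(1 + δ) ≤ 1 / δ * √(1 + δ) * ω := by
      rw [mul_right_comm, ← mul_div_right_comm, one_mul]
      exact le_mul_of_one_le_left (by positivity) ((one_le_div hδ).2 hωδ)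
    refine single ?_
    calc _ ≤ a * (c₁ * ω) := by
          gcongr
          rw [hc₁]
          linarith
      _ = a * c₁ * ω := by ring
      _ ≤ 1 / 6 * ω := by gcongr
      _ ≤ ω / 2 := by linarith

end HardInstance

/-! ### Assembly, and reduction of the convex case to the strongly convex one -/

theorem theorem2 :
    -- strongly convex case
    (∃ c : ℕ → ℝ → ℝ, (∀ n κ, 0 < c n κ) ∧
      ∀ δ : ℝ, 0 < δ → ∃ a : ℝ, 0 < a ∧
        ∀ n : ℕ, 2 ≤ n → ∀ L μ Δ ω : ℝ, 0 < μ → μ ≤ L → 0 < Δ → 0 ≤ ω →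
          (1 + δ ≤ L / μ ∨ δ ≤ ω) →
          -- one instance on `ℓ²` for all `ε`
          (∃ (f : Fin n → EllTwo → ℝ) (C : CompressorFamily n EllTwo),
            FunctionClass L μ Δ 0 f ∧ C.IsUnbiased ω ∧ C.IsIndependent ∧
            ∀ A : LinearSpanningAlgorithm.{u} f C,
              ∀ ε : ℝ, 0 < ε → ε ≤ c n (L / μ) * (μ * Δ) →
                ENNReal.ofReal (a * ((ω + (1 + ω / √(n : ℝ)) * √(L / μ))
                  * Real.log (μ * Δ / ε))) ≤ (A.complexity ε : ℝ≥0∞)) ∧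
          -- for every `ε` an instance on some `ℝᵈ`
          (∀ ε : ℝ, 0 < ε → ε ≤ c n (L / μ) * (μ * Δ) →
            ∃ (d : ℕ) (f : Fin n → EuclideanSpace ℝ (Fin d) → ℝ)
              (C : CompressorFamily n (EuclideanSpace ℝ (Fin d))),
              FunctionClass L μ Δ 0 f ∧ C.IsUnbiased ω ∧ C.IsIndependent ∧
              ∀ A : LinearSpanningAlgorithm.{u} f C,
                ENNReal.ofReal (a * ((ω + (1 + ω / √(n : ℝ)) * √(L / μ))
                  * Real.log (μ * Δ / ε))) ≤ (A.complexity ε : ℝ≥0∞))) ∧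
    -- generally convex case
    (∃ c : ℕ → ℝ, (∀ n, 0 < c n) ∧
      ∃ a : ℝ, 0 < a ∧
        ∀ n : ℕ, 2 ≤ n → ∀ L Δ ω : ℝ, 0 ≤ L → 0 < Δ → 0 ≤ ω →
          ∀ ε : ℝ, 0 < ε → ε ≤ c n * (L * Δ) →
            ∃ (d : ℕ) (f : Fin n → EuclideanSpace ℝ (Fin d) → ℝ)
              (C : CompressorFamily n (EuclideanSpace ℝ (Fin d))),
              FunctionClass L 0 Δ 0 f ∧ C.IsUnbiased ω ∧ C.IsIndependent ∧
              ∀ A : LinearSpanningAlgorithm.{u} f C,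
                ENNReal.ofReal (a * (ω * Real.log (L * Δ / ε)
                  + (1 + ω / √(n : ℝ)) * √(L * Δ / ε))) ≤ (A.complexity ε : ℝ≥0∞)) := by
  have hsc : ∀ δ : ℝ, 0 < δ → ∃ a : ℝ, 0 < a ∧
      ∀ n : ℕ, 2 ≤ n → ∀ L μ Δ ω : ℝ, 0 < μ → μ ≤ L → 0 < Δ → 0 ≤ ω →
        (1 + δ ≤ L / μ ∨ δ ≤ ω) →
        HasHardInstance.{u} EllTwo n L μ Δ ω 0 (a * (ω + (1 + ω / √(n : ℝ)) * √(L / μ))) ∧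
        ∀ ε : ℝ, 0 < ε → ε ≤ 1 / 16 * (μ * Δ) →
          ∃ (d : ℕ) (f : Fin n → EuclideanSpace ℝ (Fin d) → ℝ)
            (C : CompressorFamily n (EuclideanSpace ℝ (Fin d))),
            FunctionClass L μ Δ 0 f ∧ C.IsUnbiased ω ∧ C.IsIndependent ∧
            ∀ A : LinearSpanningAlgorithm.{u} f C,
              ENNReal.ofReal (a * ((ω + (1 + ω / √(n : ℝ)) * √(L / μ))
                * Real.log (μ * Δ / ε))) ≤ (A.complexity ε : ℝ≥0∞) := by
    intro δ hδ
    obtain ⟨a, ha, h⟩ := exists_forall_hasHardInstance.{u} hδ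
    refine ⟨a, ha, fun n hn L μ Δ ω hμ hμL hΔ hω hκω => ?_⟩
    obtain ⟨q, hq0, hq1, hq⟩ := h n hn L μ Δ ω hμ hμL hΔ hω hκω
    refine ⟨hq _ 0 le_rfl one_pos (exists_isQuadraticChain_ellTwo hq0 hq1 hΔ), ?_⟩
    intro ε hε hε1
    -- The chain is taken so long that the truncation error is below the target accuracy.
    obtain ⟨N, hN⟩ := exists_pow_lt_of_lt_one (show 0 < ε / (μ * Δ) by positivity) hq1
    have hη : q ^ (4 * (N + 1)) ≤ ε / (μ * Δ) :=
      (pow_le_pow_of_le_one hq0.le hq1.le (by omega)).trans hN.le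
    obtain ⟨f, C, hf, hC, hi, hA⟩ := hq _ (q ^ (4 * (N + 1))) (by positivity)
      (pow_lt_one₀ hq0.le hq1 (by omega)) (exists_isQuadraticChain_euclidean hq0 hq1 hΔ N.succ_pos)
    refine ⟨_, f, C, hf, hC, hi, fun A => ?_⟩
    rw [← mul_assoc]
    refine hA A ε hε hε1 ?_
    rw [le_div_iff₀ (by positivity)] at hη
    linarith
  refine ⟨⟨fun _ _ => 1 / 16, fun _ _ => by norm_num, fun δ hδ => ?_⟩,
    fun _ => 1 / 32, fun _ => by norm_num, ?_⟩
  · obtain ⟨a, ha, h⟩ := hsc δ hδ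
    refine ⟨a, ha, fun n hn L μ Δ ω hμ hμL hΔ hω hκω => ⟨?_, ?_⟩⟩
    · obtain ⟨f, C, hf, hC, hi, hA⟩ := (h n hn L μ Δ ω hμ hμL hΔ hω hκω).1
      refine ⟨f, C, hf, hC, hi, fun A ε hε hε1 => ?_⟩
      rw [← mul_assoc]
      exact hA A ε hε hε1 (by simpa using hε.le)
    · exact (h n hn L μ Δ ω hμ hμL hΔ hω hκω).2
  · obtain ⟨a, ha, h⟩ := hsc 1 one_pos
    have hweaken : ∀ {n d : ℕ} {L μ Δ : ℝ} {f : Fin n → EuclideanSpace ℝ (Fin d) → ℝ}, 0 ≤ μ →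
        FunctionClass L μ Δ 0 f → FunctionClass L 0 Δ 0 f := fun hμ hf =>
      ⟨hf.differentiable,
        fun i x y => le_trans (by gcongr) (hf.lower i x y), hf.upper, hf.exists_minimizer⟩
    refine ⟨a / 8, by positivity, fun n hn L Δ ω hL hΔ hω ε hε hε1 => ?_⟩
    have hLΔ : 32 * ε ≤ L * Δ := by linarith
    have hL0 : 0 < L := hL.lt_of_ne fun h0 => by rw [← h0] at hLΔ; linarith
    have hx : 32 ≤ L * Δ / ε := by rwa [le_div_iff₀ hε]
    have hlog0 : 0 ≤ Real.log (L * Δ / ε) := Real.log_nonneg (by linarith)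
    -- If the logarithmic term dominates, `μ = L / 2` suffices. The requirement `ε ≤ μΔ / 16` is
    -- then `ε ≤ LΔ / 32`, the constant chosen above.
    by_cases hcase : (1 + ω / √(n : ℝ)) * √(L * Δ / ε) ≤ ω * Real.log (L * Δ / ε)
    · obtain ⟨d, f, C, hf, hC, hi, hA⟩ := (h n hn L (L / 2) Δ ω (by positivity) (by linarith) hΔ hω
        (.inl (by field_simp; norm_num))).2 ε hε (by linarith)
      refine ⟨d, f, C, hweaken (by positivity) hf, hC, hi, fun A => le_trans ?_ (hA A)⟩
      apply ENNReal.ofReal_le_ofReal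
      have h1 : Real.log (L * Δ / ε) ≤ 2 * Real.log (L / 2 * Δ / ε) := by
        have h2 : L / 2 * Δ / ε = L * Δ / ε / 2 := by ring
        have h3 : 2 * Real.log (L * Δ / ε / 2) = Real.log ((L * Δ / ε / 2) ^ 2) := by
          rw [Real.log_pow]
          norm_num
        rw [h2, h3]
        exact Real.log_le_log (by linarith) (by nlinarith)
      have h4 : 0 ≤ (1 + ω / √(n : ℝ)) * √(L / (L / 2)) * Real.log (L / 2 * Δ / ε) :=
        mul_nonneg (by positivity) (by linarith)
      have h5 := mul_le_mul_of_nonneg_left h1 hω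
      have h6 : 0 ≤ ω * Real.log (L * Δ / ε) := mul_nonneg hω hlog0
      calc _ ≤ a / 8 * (8 * (ω * Real.log (L / 2 * Δ / ε))) := by gcongr; linarith
        _ = a * (ω * Real.log (L / 2 * Δ / ε)) := by ring
        _ ≤ _ := mul_le_mul_of_nonneg_left (by linarith) ha.le
    -- Otherwise `μ = 16ε / Δ`, the smallest value for which accuracy `ε` is admissible: the
    -- logarithm becomes `log 16 ≥ 1` and `√κ = √(LΔ/ε) / 4`. The bound `32ε ≤ LΔ` gives `κ ≥ 2`, as
    -- required for `δ = 1`.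
    · have hμ : 16 * ε / Δ * Δ = 16 * ε := by field_simp
      have hμL : 2 * (16 * ε / Δ) ≤ L := by
        rw [← mul_div_assoc, div_le_iff₀ hΔ]
        linarith
      obtain ⟨d, f, C, hf, hC, hi, hA⟩ := (h n hn L (16 * ε / Δ) Δ ω (by positivity)
        (le_trans (by linarith [show 0 < 16 * ε / Δ by positivity]) hμL) hΔ hω
        (.inl (by rw [le_div_iff₀ (by positivity)]; linarith))).2 ε hε (by rw [hμ]; linarith)
      refine ⟨d, f, C, hweaken (by positivity) hf, hC, hi, fun A => le_trans ?_ (hA A)⟩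
      apply ENNReal.ofReal_le_ofReal
      have h1 : √(L / (16 * ε / Δ)) = √(L * Δ / ε) / 4 := by
        have h2 : L / (16 * ε / Δ) = L * Δ / ε / 4 ^ 2 := by
          field_simp
          norm_num
        rw [h2, Real.sqrt_div' _ (by norm_num), Real.sqrt_sq (by norm_num)]
      have h3 : 1 ≤ Real.log (16 * ε / Δ * Δ / ε) := by
        rw [hμ, mul_div_cancel_right₀ _ hε.ne', Real.le_log_iff_exp_le (by norm_num)]
        linarith [Real.exp_one_lt_d9]
      rw [h1]
      calc _ ≤ a / 8 * (2 * ((1 + ω / √(n : ℝ)) * √(L * Δ / ε))) := by gcongr; linarith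
        _ = a * ((1 + ω / √(n : ℝ)) * (√(L * Δ / ε) / 4) * 1) := by ring
        _ ≤ _ := by
          gcongr
          linarith
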